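/- Let $C$ be a simple closed contour in $\mathbb{C}$, i.e. a closed curve without self-intersections that is piecewise continuously differentiable with nonvanishing (at end points of the pieces: one-sided) derivative, traversed counter-clockwise. Let $\mathcal{D}^+$ be the bounded open domain inside $C$ and $\mathcal{D}^-$ the unbounded open domain outside $C$. Let $f$ be holomorphic in $\mathcal{D}^+$ and in a neighbourhood of $C$. Then for every $n=0,1,2,\dots$ (with $f^{(0)}=f$): (i) $f^{(n)}$ is uniformly continuous on the closed domain $\mathcal{D}^+\cup C$, and for every $z\in C$ the limit of $f^{(n)}$ at $z$ from $\mathcal{D}^+$ exists and equals $f^{(n)}(z)$; (ii) for every $z\in C$ at which $C$ has no corner or cusp (the two one-sided tangent directions agree; thus for every $z\in C$ if $C$ is a regular $C^1$ curve), the principal value $$P_n(z)=\mathcal{P}\oint_C\frac{f^{(n)}(t)}{t-z}\,dt=\lim_{\varepsilon\to0^+}\int_{C\cap\{|t-z|>\varepsilon\}}\frac{f^{(n)}(t)}{t-z}\,dt$$ exists, and $$f^{(n)}(z)=\frac{1}{\pi i}\,\mathcal{P}\oint_C\frac{f^{(n)}(t)}{t-z}\,dt ;$$ moreover the Cauchy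 integral $\frac{1}{2\pi i}\oint_C\frac{f^{(n)}(t)}{t-w}\,dt$ tends to $\tfrac12 f^{(n)}(z)+\frac{1}{2\pi i}P_n(z)$ as $w\to z$ from $\mathcal{D}^+$, and to $-\tfrac12 f^{(n)}(z)+\frac{1}{2\pi i}P_n(z)$ as $w\to z$ from $\mathcal{D}^-$ (these limits being $f^{(n)}(z)$ and $0$, respectively). -/

import Mathlib

open Set Filter Topology

noncomputable section

/-- A simple closed contour: a closed curve, given as a `1`-periodic map on `ℝ`, which does not
intersect itself and is piecewise continuously differentiable with nonvanishing derivative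
(one-sided derivative at the end points of the pieces). -/
structure IsSimpleClosedContour (γ : ℝ → ℂ) : Prop where
  continuous : Continuous γ
  periodic : Function.Periodic γ 1
  injOn : InjOn γ (Ico 0 1)
  piecewise_regular : ∃ (k : ℕ) (a : ℕ → ℝ), a 0 = 0 ∧ a k = 1 ∧ ∀ i < k,
    a i < a (i + 1) ∧ ContDiffOn ℝ 1 γ (Icc (a i) (a (i + 1))) ∧
      ∀ s ∈ Icc (a i) (a (i + 1)), derivWithin γ (Icc (a i) (a (i + 1))) s ≠ 0

/-- The curve has no corner or cusp at the parameter `s`: the left and right derivatives are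
nonzero and point in the same direction. -/
def IsSmoothPoint (γ : ℝ → ℂ) (s : ℝ) : Prop :=
  ∃ v : ℂ, v ≠ 0 ∧ ∃ c : ℝ, 0 < c ∧
    HasDerivWithinAt γ v (Iic s) s ∧ HasDerivWithinAt γ ((c : ℂ) * v) (Ici s) s

/-- The open domain inside the contour: the points off the curve whose connected component in
the complement of the curve is bounded. -/
def insideDomain (γ : ℝ → ℂ) : Set ℂ :=
  {z | z ∉ range γ ∧ Bornology.IsBounded (connectedComponentIn (range γ)ᶜ z)}

/-- The open domain outside the contour: the points off the curve whose connected component in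
the complement of the curve is unbounded. -/
def outsideDomain (γ : ℝ → ℂ) : Set ℂ :=
  {z | z ∉ range γ ∧ ¬ Bornology.IsBounded (connectedComponentIn (range γ)ᶜ z)}

/-- The contour integral `∮ g(t) dt`. -/
def contourIntegral (γ : ℝ → ℂ) (g : ℂ → ℂ) : ℂ :=
  ∫ s in (0 : ℝ)..1, g (γ s) * deriv γ s

/-- The winding number `(1 / 2πi) ∮ dt / (t - z)` of the curve around a point off the curve. -/
def windingNumber (γ : ℝ → ℂ) (z : ℂ) : ℂ :=
  1 / (2 * Real.pi * Complex.I) * contourIntegral γ (fun t => 1 / (t - z))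

/-- The contour is traversed counter-clockwise: it winds once around each point inside it. -/
def IsPositivelyOriented (γ : ℝ → ℂ) : Prop :=
  ∀ z ∈ insideDomain γ, windingNumber γ z = 1

/-- The Cauchy integral `(1 / 2πi) ∮ g(t) / (t - z) dt`. -/
def cauchyIntegral (γ : ℝ → ℂ) (g : ℂ → ℂ) (z : ℂ) : ℂ :=
  1 / (2 * Real.pi * Complex.I) * contourIntegral γ (fun t => g t / (t - z))

/-- The principal value of `∮ g(t) / (t - z) dt` exists and equals `P`: it is the limit, as
`ε → 0+`, of the integral over the part of the curve with `|t - z| > ε`. -/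
def HasCauchyPrincipalValue (γ : ℝ → ℂ) (g : ℂ → ℂ) (z P : ℂ) : Prop :=
  Tendsto
    (fun ε : ℝ => ∫ s in {s : ℝ | s ∈ Icc (0 : ℝ) 1 ∧ ε < ‖γ s - z‖},
      g (γ s) / (γ s - z) * deriv γ s)
    (𝓝[>] 0) (𝓝 P)

end

/-! Put `U = insideDomain γ ∪ N`, an open neighbourhood of the closed inner domain. Every derivative
`g = iteratedDeriv n f` is holomorphic on `U`, and the closed inner domain is compact, being bounded
with open complement `outsideDomain γ`; this gives (i).

For (ii), Cauchy's theorem comes from Dixon's argument. The function `w ↦ ∮ dslope g w`, given on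
`outsideDomain γ` by `∮ g(t)/(t - w) dt`, is entire and tends to `0` at infinity, so it vanishes
identically. Hence the Cauchy integral is `g` inside and `0` outside, and also `∮ dslope g z = 0`
for `z` on the curve itself.

On the curve, write `g(t)/(t - z) = dslope g z t + g(z)/(t - z)`. The first term is bounded and
integrates to `0`, so it remains to find the principal value `L` of `∮ dt/(t - z)`. At a smooth
point a logarithm on each branch shows that `L` exists: the two divergences `log ε` cancel. Moving
`z` by `±η` along the normal changes the integral to `L ± πi` in the limit. Off the curve the
integral is `0` or `2πi`, so both `L + πi` and `L - πi` lie in `{0, 2πi}`, which forces `L = πi`.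
Neither the Jordan curve theorem nor knowledge of which normal points inwards is needed. -/

open MeasureTheory

/-- A continuous curve that is differentiable off a countable set, with bounded derivative. -/
structure HasBoundedDeriv (γ : ℝ → ℂ) : Prop where
  continuous : Continuous γ
  differentiableAt : ∃ E : Set ℝ, E.Countable ∧ ∀ s ∉ E, DifferentiableAt ℝ γ s
  bounded : ∃ M, ∀ s, ‖deriv γ s‖ ≤ M

/-! ### Contours as curves with bounded derivative -/

theorem Function.Periodic.deriv_real {γ : ℝ → ℂ} {T : ℝ} (h : Function.Periodic γ T) :
    Function.Periodic (deriv γ) T := by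
  intro s
  rw [← deriv_comp_add_const]
  congr 1
  exact funext h

theorem exists_mem_Icc_of_partition (a : ℕ → ℝ) (k : ℕ) {s : ℝ} (h0 : a 0 ≤ s) (hk : s ≤ a k)
    (hk0 : 0 < k) : ∃ i < k, s ∈ Icc (a i) (a (i + 1)) := by
  induction k with
  | zero => omega
  | succ k ih =>
    rcases le_or_gt (a k) s with h | h
    · exact ⟨k, by omega, h, hk⟩
    · rcases Nat.eq_zero_or_pos k with rfl | hk'
      · exact absurd h0 (not_le.2 h)
      · obtain ⟨i, hi, hs⟩ := ih h.le hk'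
        exact ⟨i, by omega, hs⟩

/-- On each closed piece the one-sided derivative is continuous on a compact interval, and at a
corner `deriv` takes the default value `0`. The exceptional set consists of the integer translates
of the nodes. Later arguments use piecewise regularity only through this. -/
theorem IsSimpleClosedContour.hasBoundedDeriv {γ : ℝ → ℂ} (hγ : IsSimpleClosedContour γ) :
    HasBoundedDeriv γ := by
  obtain ⟨k, a, ha0, hak, ha⟩ := hγ.piecewise_regular
  have hk0 : 0 < k := by
    rcases Nat.eq_zero_or_pos k with rfl | h
    · rw [ha0] at hak; norm_num at hak
    · exact h
  have hcover : ∀ s : ℝ, ∃ i < k, Int.fract s ∈ Icc (a i) (a (i + 1)) := fun s =>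
    exists_mem_Icc_of_partition a k (ha0 ▸ Int.fract_nonneg s) (hak ▸ (Int.fract_lt_one s).le) hk0
  have hshift : ∀ s : ℝ, (fun x => γ (x + ⌊s⌋)) = γ := fun s => by
    funext x
    simpa using hγ.periodic.int_mul ⌊s⌋ x
  have hder : ∀ s, deriv γ s = deriv γ (Int.fract s) := by
    intro s
    have := hγ.periodic.deriv_real.int_mul ⌊s⌋ (Int.fract s)
    rw [mul_one, Int.fract_add_floor] at this
    exact this
  refine ⟨hγ.continuous, ⟨⋃ n : ℤ, ⋃ i : ℕ, {a i + n}, ?_, ?_⟩, ?_⟩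
  · exact countable_iUnion fun n => countable_iUnion fun i => countable_singleton _
  · intro s hs
    obtain ⟨i, hi, hm⟩ := hcover s
    have hne : ∀ j, a j ≠ Int.fract s := by
      intro j hj
      refine hs (mem_iUnion.2 ⟨⌊s⌋, mem_iUnion.2 ⟨j, ?_⟩⟩)
      rw [hj, Int.fract_add_floor]; rfl
    have hd : DifferentiableAt ℝ γ (Int.fract s) :=
      ((ha i hi).2.1.differentiableOn one_ne_zero).differentiableAt
        (Icc_mem_nhds (lt_of_le_of_ne hm.1 (hne i)) (lt_of_le_of_ne hm.2 (hne (i + 1)).symm))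
    rw [← hshift s] at hd
    have := (differentiableAt_comp_add_const (f := γ) (a := Int.fract s) (b := (⌊s⌋ : ℝ))).1 hd
    rwa [Int.fract_add_floor] at this
  · have hb : ∀ i : ℕ, ∃ M, i < k → ∀ s ∈ Icc (a i) (a (i + 1)), ‖deriv γ s‖ ≤ M := by
      intro i
      by_cases hi : i < k
      · have hu := uniqueDiffOn_Icc (ha i hi).1
        obtain ⟨M, hM⟩ := isCompact_Icc.exists_bound_of_continuousOn
          ((ha i hi).2.1.continuousOn_derivWithin hu le_rfl)
        refine ⟨M, fun _ s hs => ?_⟩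
        by_cases hd : DifferentiableAt ℝ γ s
        · rw [← hd.derivWithin (hu s hs)]
          exact hM s hs
        · rw [deriv_zero_of_not_differentiableAt hd, norm_zero]
          exact (norm_nonneg _).trans (hM s hs)
      · exact ⟨0, fun h => absurd h hi⟩
    choose M hM using hb
    refine ⟨∑ i ∈ Finset.range k, |M i|, fun s => ?_⟩
    obtain ⟨i, hi, hm⟩ := hcover s
    rw [hder]
    exact ((hM i hi _ hm).trans (le_abs_self _)).trans
      (Finset.single_le_sum (f := fun i => |M i|) (fun _ _ => abs_nonneg _) (Finset.mem_range.2 hi))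

namespace HasBoundedDeriv

variable {γ : ℝ → ℂ}

theorem intervalIntegrable (h : HasBoundedDeriv γ) (a b : ℝ) :
    IntervalIntegrable (deriv γ) volume a b := by
  obtain ⟨M, hM⟩ := h.bounded
  refine (intervalIntegrable_const (c := M)).mono_fun
    (measurable_deriv γ).aestronglyMeasurable (ae_of_all _ fun s => ?_)
  exact (hM s).trans (le_abs_self M)

theorem intervalIntegrable_mul (h : HasBoundedDeriv γ) {a b : ℝ} {F : ℝ → ℂ}
    (hF : ContinuousOn F (uIcc a b)) :
    IntervalIntegrable (fun s => F s * deriv γ s) volume a b :=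
  (h.intervalIntegrable a b).continuousOn_mul hF

/-- The factor `u` rotates the arc off the branch cut and cancels in the logarithmic derivative. -/
theorem integral_inv_sub_mul_deriv (h : HasBoundedDeriv γ) {a b : ℝ} (hab : a ≤ b) {w u : ℂ}
    (hs : ∀ s ∈ Icc a b, u * (γ s - w) ∈ Complex.slitPlane) :
    ∫ s in a..b, (γ s - w)⁻¹ * deriv γ s =
      Complex.log (u * (γ b - w)) - Complex.log (u * (γ a - w)) := by
  obtain ⟨E, hE, hd⟩ := h.differentiableAt
  have hne : ∀ s ∈ Icc a b, γ s - w ≠ 0 := fun s hs' h0 =>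
    Complex.slitPlane_ne_zero (hs s hs') (by rw [h0, mul_zero])
  refine integral_eq_of_hasDerivAt_off_countable_of_le (fun s => Complex.log (u * (γ s - w))) _
    hab hE ?_ ?_ ?_
  · exact (continuousOn_const.mul (h.continuous.continuousOn.sub continuousOn_const)).clog hs
  · intro s hs'
    have hI := Ioo_subset_Icc_self hs'.1
    have h1 := (((hd s hs'.2).hasDerivAt.sub_const w).const_mul u).clog_real (hs s hI)
    convert! h1 using 1
    have hu : u ≠ 0 := fun h0 => Complex.slitPlane_ne_zero (hs s hI) (by rw [h0, zero_mul])
    have := hne s hI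
    field_simp
  · refine h.intervalIntegrable_mul ?_
    rw [uIcc_of_le hab]
    exact (h.continuous.continuousOn.sub continuousOn_const).inv₀ hne

end HasBoundedDeriv

/-! ### The Cauchy integral off the curve -/

/-- The set is the image of a half-plane under `exp`. -/
theorem isPreconnected_compl_closedBall (R : ℝ) (hR : 0 < R) :
    IsPreconnected {w : ℂ | R < ‖w‖} := by
  have hc : IsPreconnected {z : ℂ | Real.log R < z.re} :=
    (convex_halfSpace_re_gt (Real.log R)).isPreconnected
  convert hc.image Complex.exp Complex.continuous_exp.continuousOn using 1
  ext w
  simp only [mem_ofPred_eq, mem_image]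
  constructor
  · intro hw
    have hw0 : w ≠ 0 := by rintro rfl; rw [norm_zero] at hw; linarith
    exact ⟨Complex.log w, by rw [Complex.log_re]; exact Real.log_lt_log hR hw,
      Complex.exp_log hw0⟩
  · rintro ⟨z, hz, rfl⟩
    rw [Complex.norm_exp]
    exact (Real.log_lt_iff_lt_exp hR).1 hz

theorem not_isBounded_compl_closedBall (R : ℝ) : ¬ Bornology.IsBounded {w : ℂ | R < ‖w‖} := by
  intro h
  obtain ⟨S, hS⟩ := h.exists_norm_le
  have := hS ((max (|R| + 1) (S + 1) : ℝ) : ℂ) (by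
    simp only [mem_ofPred_eq, Complex.norm_real, Real.norm_eq_abs]
    exact lt_of_lt_of_le (lt_of_lt_of_le (by linarith [le_abs_self R]) (le_max_left _ _))
      (le_abs_self _))
  rw [Complex.norm_real, Real.norm_eq_abs] at this
  linarith [le_max_right (|R| + 1) (S + 1), le_abs_self (max (|R| + 1) (S + 1))]

/-! ### Topology of the two domains and values of the winding integral -/

namespace IsSimpleClosedContour

variable {γ : ℝ → ℂ}

theorem range_eq (hγ : IsSimpleClosedContour γ) : range γ = γ '' Icc 0 1 := by
  refine Subset.antisymm ?_ (image_subset_range _ _)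
  rintro _ ⟨s, rfl⟩
  refine ⟨Int.fract s, ⟨Int.fract_nonneg s, (Int.fract_lt_one s).le⟩, ?_⟩
  have := hγ.periodic.int_mul ⌊s⌋ (Int.fract s)
  rw [mul_one, Int.fract_add_floor] at this
  exact this.symm

theorem isCompact_range (hγ : IsSimpleClosedContour γ) : IsCompact (range γ) := by
  rw [hγ.range_eq]
  exact isCompact_Icc.image hγ.continuous

theorem isOpen_compl_range (hγ : IsSimpleClosedContour γ) : IsOpen (range γ)ᶜ :=
  hγ.isCompact_range.isClosed.isOpen_compl

theorem exists_norm_lt (hγ : IsSimpleClosedContour γ) : ∃ R, 0 < R ∧ ∀ s, ‖γ s‖ < R := by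
  obtain ⟨R, hR⟩ := hγ.isCompact_range.isBounded.exists_norm_le
  exact ⟨|R| + 1, by positivity, fun s => by
    linarith [hR _ (mem_range_self s), le_abs_self R]⟩

theorem isOpen_insideDomain (hγ : IsSimpleClosedContour γ) : IsOpen (insideDomain γ) := by
  rw [isOpen_iff_mem_nhds]
  rintro z ⟨hz, hb⟩
  filter_upwards [(hγ.isOpen_compl_range.connectedComponentIn (x := z)).mem_nhds
    (mem_connectedComponentIn hz)] with w hw
  exact ⟨connectedComponentIn_subset _ _ hw, by rwa [← connectedComponentIn_eq hw]⟩

theorem isOpen_outsideDomain (hγ : IsSimpleClosedContour γ) : IsOpen (outsideDomain γ) := by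
  rw [isOpen_iff_mem_nhds]
  rintro z ⟨hz, hb⟩
  filter_upwards [(hγ.isOpen_compl_range.connectedComponentIn (x := z)).mem_nhds
    (mem_connectedComponentIn hz)] with w hw
  exact ⟨connectedComponentIn_subset _ _ hw, by rwa [← connectedComponentIn_eq hw]⟩

theorem insideDomain_union_range (γ : ℝ → ℂ) :
    insideDomain γ ∪ range γ = (outsideDomain γ)ᶜ := by
  ext z
  simp only [insideDomain, outsideDomain, mem_union, mem_ofPred_eq, mem_compl_iff]
  tauto

theorem mem_outsideDomain_of_norm_lt {R : ℝ} (hR : 0 < R) (h : ∀ s, ‖γ s‖ < R) {w : ℂ}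
    (hw : R < ‖w‖) : w ∈ outsideDomain γ := by
  have hsub : {w : ℂ | R < ‖w‖} ⊆ (range γ)ᶜ := by
    rintro x hx ⟨s, rfl⟩
    exact lt_asymm hx (h s)
  refine ⟨hsub hw, fun hb => not_isBounded_compl_closedBall R (hb.subset ?_)⟩
  exact (isPreconnected_compl_closedBall R hR).subset_connectedComponentIn hw hsub

theorem isCompact_insideDomain_union_range (hγ : IsSimpleClosedContour γ) :
    IsCompact (insideDomain γ ∪ range γ) := by
  rw [insideDomain_union_range]
  refine Metric.isCompact_of_isClosed_isBounded hγ.isOpen_outsideDomain.isClosed_compl ?_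
  obtain ⟨R, hR, h⟩ := hγ.exists_norm_lt
  refine (Metric.isBounded_closedBall (x := (0 : ℂ)) (r := R)).subset fun z hz => ?_
  rw [mem_closedBall_zero_iff]
  by_contra! hlt
  exact hz (mem_outsideDomain_of_norm_lt hR h hlt)

theorem tendsto_contourIntegral_div_sub (hγ : IsSimpleClosedContour γ) {g : ℂ → ℂ}
    (hg : Continuous fun s => g (γ s)) :
    Tendsto (fun w => contourIntegral γ fun t => g t / (t - w)) (cocompact ℂ) (𝓝 0) := by
  obtain ⟨R, hR, h⟩ := hγ.exists_norm_lt
  obtain ⟨M, hM⟩ := hγ.hasBoundedDeriv.bounded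
  obtain ⟨G, hG⟩ := (isCompact_Icc (a := (0 : ℝ)) (b := 1)).exists_bound_of_continuousOn
    hg.continuousOn
  have hG0 : 0 ≤ G := (norm_nonneg _).trans (hG 0 (by simp))
  have hM0 : 0 ≤ M := (norm_nonneg _).trans (hM 0)
  have hlim : Tendsto (fun w : ℂ => G * M * (‖w‖ - R)⁻¹) (cocompact ℂ) (𝓝 0) := by
    have : Tendsto (fun w : ℂ => ‖w‖ - R) (cocompact ℂ) atTop :=
      tendsto_atTop_add_const_right _ _ (tendsto_norm_cocompact_atTop (E := ℂ))
    simpa using (tendsto_inv_atTop_zero.comp this).const_mul (G * M)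
  refine squeeze_zero_norm' ?_ hlim
  filter_upwards [(tendsto_norm_cocompact_atTop (E := ℂ)).eventually_gt_atTop R] with w hw
  have := intervalIntegral.norm_integral_le_of_norm_le_const (a := 0) (b := 1)
    (f := fun s => g (γ s) / (γ s - w) * deriv γ s) (C := G * M * (‖w‖ - R)⁻¹) ?_
  · simpa [contourIntegral] using this
  · intro s hs
    rw [uIoc_of_le zero_le_one] at hs
    have h1 : ‖w‖ - R ≤ ‖γ s - w‖ := by
      have := norm_sub_norm_le w (γ s)
      rw [norm_sub_rev] at this
      linarith [h s]
    have h0 : 0 < ‖w‖ - R := by linarith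
    rw [norm_mul, norm_div, div_eq_mul_inv]
    calc ‖g (γ s)‖ * ‖γ s - w‖⁻¹ * ‖deriv γ s‖ ≤ G * (‖w‖ - R)⁻¹ * M := by
          gcongr
          · exact hG s (Ioc_subset_Icc_self hs)
          · exact hM s
      _ = _ := by ring

/-- For `x` close to `w` the quotient `(γ - x)/(γ - w)` stays within distance `1` of `1`. Its
principal logarithm is then a primitive of the difference of the integrands and returns to its
initial value around the closed curve. -/
theorem contourIntegral_inv_locally_const (hγ : IsSimpleClosedContour γ) {w : ℂ}
    (hw : w ∉ range γ) :
    ∀ᶠ x in 𝓝 w, contourIntegral γ (fun t => 1 / (t - x)) =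
      contourIntegral γ (fun t => 1 / (t - w)) := by
  obtain ⟨r, hr, hball⟩ := Metric.isOpen_iff.1 hγ.isOpen_compl_range w hw
  have hdist : ∀ s, r ≤ ‖γ s - w‖ := by
    intro s
    by_contra! hlt
    exact hball (mem_ball_iff_norm.2 hlt) (mem_range_self s)
  have hne : ∀ s, γ s - w ≠ 0 := fun s h0 => hw ⟨s, sub_eq_zero.1 h0⟩
  filter_upwards [Metric.ball_mem_nhds w hr] with x hx
  have hxw : ‖w - x‖ < r := by rw [norm_sub_rev]; exact mem_ball_iff_norm.1 hx
  have hnx : ∀ s, γ s - x ≠ 0 := fun s h0 => hball hx ⟨s, sub_eq_zero.1 h0⟩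
  have hslit : ∀ s, (γ s - x) / (γ s - w) ∈ Complex.slitPlane := by
    intro s
    have : (γ s - x) / (γ s - w) = 1 + (w - x) / (γ s - w) := by
      have := hne s
      field_simp
      ring
    rw [this]
    apply Complex.mem_slitPlane_of_norm_lt_one
    rw [norm_div, div_lt_one (norm_pos_iff.2 (hne s))]
    exact hxw.trans_le (hdist s)
  obtain ⟨E, hE, hd⟩ := hγ.hasBoundedDeriv.differentiableAt
  have hi : ∀ y, (∀ s, γ s - y ≠ 0) →
      IntervalIntegrable (fun s => 1 / (γ s - y) * deriv γ s) volume 0 1 := fun y hy =>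
    hγ.hasBoundedDeriv.intervalIntegrable_mul
      (continuousOn_const.div (hγ.continuous.continuousOn.sub continuousOn_const)
        fun s _ => hy s)
  rw [← sub_eq_zero, contourIntegral, contourIntegral,
    ← intervalIntegral.integral_sub (hi x hnx) (hi w hne)]
  rw [integral_eq_of_hasDerivAt_off_countable_of_le
    (fun s => Complex.log ((γ s - x) / (γ s - w))) _ zero_le_one hE ?_ ?_
    ((hi x hnx).sub (hi w hne))]
  · have : γ 1 = γ 0 := by simpa using hγ.periodic 0
    simp [this]
  · exact ((hγ.continuous.continuousOn.sub continuousOn_const).div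
      (hγ.continuous.continuousOn.sub continuousOn_const) fun s _ => hne s).clog
      fun s _ => hslit s
  · intro s hs
    have h1 := (((hd s hs.2).hasDerivAt.sub_const x).div
      ((hd s hs.2).hasDerivAt.sub_const w) (hne s)).clog_real (hslit s)
    convert! h1 using 1
    have h2 := hne s
    have h3 := hnx s
    rw [Pi.div_apply]
    field_simp

theorem contourIntegral_inv_eq_zero (hγ : IsSimpleClosedContour γ) {z : ℂ}
    (hz : z ∈ outsideDomain γ) : contourIntegral γ (fun t => 1 / (t - z)) = 0 := by
  set I : ℂ → ℂ := fun z => contourIntegral γ (fun t => 1 / (t - z))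
  set U := connectedComponentIn (range γ)ᶜ z
  have hder : ∀ w ∈ U, HasDerivAt I 0 w := fun w hw =>
    (hasDerivAt_const w (I w)).congr_of_eventuallyEq
      (hγ.contourIntegral_inv_locally_const (connectedComponentIn_subset _ _ hw))
  have hconst : ∀ w ∈ U, I w = I z := fun w hw =>
    (hγ.isOpen_compl_range.connectedComponentIn).is_const_of_deriv_eq_zero
      isPreconnected_connectedComponentIn
      (fun w hw => (hder w hw).differentiableAt.differentiableWithinAt)
      (fun w hw => (hder w hw).deriv) hw (mem_connectedComponentIn hz.1)
  have hlim : Tendsto I (cocompact ℂ) (𝓝 0) :=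
    hγ.tendsto_contourIntegral_div_sub (g := fun _ => 1) continuous_const
  by_contra hne
  -- The integral is constant on the component. Were the constant nonzero, decay at infinity would
  -- confine the component to a compact set.
  have hev := hlim.eventually_ne (Ne.symm hne)
  rw [(hasBasis_cocompact).eventually_iff] at hev
  obtain ⟨K, hK, hKs⟩ := hev
  refine hz.2 (hK.isBounded.subset fun w hw => ?_)
  by_contra hwK
  exact hKs hwK (hconst w hw)

theorem contourIntegral_inv_inside (hpos : IsPositivelyOriented γ) {z : ℂ}
    (hz : z ∈ insideDomain γ) :
    contourIntegral γ (fun t => 1 / (t - z)) = 2 * Real.pi * Complex.I := by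
  have := hpos z hz
  rw [windingNumber, one_div_mul_eq_div, div_eq_one_iff_eq Complex.two_pi_I_ne_zero] at this
  exact this

end IsSimpleClosedContour

/-! ### Cauchy's theorem by Dixon's argument -/

/-- Differentiation under the integral sign; holomorphy in `w` turns the bound on `Φ` into a bound
on its `w`-derivative by Cauchy's estimate, so no joint regularity is required. -/
theorem HasBoundedDeriv.differentiableAt_integral_mul_deriv {γ : ℝ → ℂ} (h : HasBoundedDeriv γ)
    {Φ : ℂ → ℝ → ℂ} {w₀ : ℂ} {r M : ℝ} (hr : 0 < r)
    (hd : ∀ s, DifferentiableOn ℂ (fun w => Φ w s) (Metric.ball w₀ r))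
    (hc : ∀ w ∈ Metric.ball w₀ r, Continuous (Φ w))
    (hb : ∀ w ∈ Metric.ball w₀ r, ∀ s, ‖Φ w s‖ ≤ M) :
    DifferentiableAt ℂ (fun w => ∫ s in (0 : ℝ)..1, Φ w s * deriv γ s) w₀ := by
  obtain ⟨K, hK⟩ := h.bounded
  have hw₀ : w₀ ∈ Metric.ball w₀ r := Metric.mem_ball_self hr
  have hK0 : 0 ≤ K := (norm_nonneg _).trans (hK 0)
  -- The derivative is a pointwise limit of difference quotients along a sequence tending to `w₀`,
  -- each continuous in `s`.
  have hmeas : Measurable fun s => deriv (fun w => Φ w s) w₀ := by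
    have hpt : ∀ n : ℕ, w₀ + ((r / 2 / (n + 1) : ℝ) : ℂ) ∈ Metric.ball w₀ r := by
      intro n
      rw [mem_ball_iff_norm, add_sub_cancel_left, Complex.norm_real, Real.norm_eq_abs,
        abs_of_pos (by positivity), div_lt_iff₀ (by positivity)]
      nlinarith [(Nat.cast_nonneg n : (0 : ℝ) ≤ n)]
    refine measurable_of_tendsto_metrizable
      (f := fun (n : ℕ) s => slope (fun w => Φ w s) w₀ (w₀ + ((r / 2 / (n + 1) : ℝ) : ℂ))) ?_ ?_
    · intro n
      simp only [slope_def_field]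
      exact (((hc _ (hpt n)).sub (hc _ hw₀)).div_const _).measurable
    · rw [tendsto_pi_nhds]
      intro s
      refine ((hd s).differentiableAt (Metric.ball_mem_nhds _ hr)).hasDerivAt.tendsto_slope.comp ?_
      refine tendsto_nhdsWithin_iff.2 ⟨?_, Eventually.of_forall fun n => ?_⟩
      · have h1 : Tendsto (fun n : ℕ => r / 2 / ((n : ℝ) + 1)) atTop (𝓝 0) :=
          tendsto_const_nhds.div_atTop
            (tendsto_atTop_add_const_right _ _ tendsto_natCast_atTop_atTop)
        simpa using ((Complex.continuous_ofReal.tendsto 0).comp h1).const_add w₀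
      · simp only [mem_compl_iff, mem_singleton_iff, add_eq_left, Complex.ofReal_eq_zero]
        positivity
  have hbd : ∀ w ∈ Metric.ball w₀ (r / 2), ∀ s, ‖deriv (fun w => Φ w s) w‖ ≤ M / (r / 4) := by
    intro w hw s
    have hsub : Metric.closedBall w (r / 4) ⊆ Metric.ball w₀ r := by
      refine Metric.closedBall_subset_ball' ?_
      rw [Metric.mem_ball] at hw
      linarith
    refine Complex.norm_deriv_le_of_forall_mem_sphere_norm_le (by positivity)
      ((hd s).diffContOnCl_ball hsub) ?_
    exact fun z hz => hb z (hsub (Metric.sphere_subset_closedBall hz)) s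
  refine (intervalIntegral.hasDerivAt_integral_of_dominated_loc_of_deriv_le
    (F' := fun w s => deriv (fun w => Φ w s) w * deriv γ s) (bound := fun _ => M / (r / 4) * K)
    (Metric.ball_mem_nhds w₀ (half_pos hr)) ?_ ?_ ?_ ?_ ?_ ?_).2.differentiableAt
  · filter_upwards [Metric.ball_mem_nhds w₀ hr] with w hw
    exact ((hc w hw).measurable.mul (measurable_deriv γ)).aestronglyMeasurable
  · exact h.intervalIntegrable_mul (hc _ hw₀).continuousOn
  · exact (hmeas.mul (measurable_deriv γ)).aestronglyMeasurable
  · refine ae_of_all _ fun s _ w hw => ?_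
    rw [norm_mul]
    exact mul_le_mul (hbd w hw s) (hK s) (norm_nonneg _)
      ((norm_nonneg _).trans (hbd w hw s))
  · exact intervalIntegrable_const
  · refine ae_of_all _ fun s _ w hw => ?_
    exact (((hd s).differentiableAt (Metric.isOpen_ball.mem_nhds
      (Metric.ball_subset_ball (by linarith) hw))).hasDerivAt).mul_const _

/-- Symmetry transfers holomorphy of `dslope` in its second point to the first. -/
theorem dslope_comm {g : ℂ → ℂ} (a b : ℂ) : dslope g a b = dslope g b a := by
  rcases eq_or_ne a b with rfl | h
  · rfl
  · rw [dslope_of_ne _ h.symm, dslope_of_ne _ h, slope_comm]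

/-- Near the diagonal the mean value inequality bounds the slope by `sup |g'|` on a disc; for `t`
outside that disc, `|t - w| ≥ r` and the trivial bound `2G/r` suffices. -/
theorem exists_norm_dslope_le {U K : Set ℂ} (hU : IsOpen U) {g : ℂ → ℂ}
    (hg : DifferentiableOn ℂ g U) (hK : IsCompact K) (hKU : K ⊆ U) {w₀ : ℂ} (hw₀ : w₀ ∈ U) :
    ∃ r M, 0 < r ∧ Metric.ball w₀ r ⊆ U ∧ ∀ w ∈ Metric.ball w₀ r, ∀ t ∈ K,
      ‖dslope g w t‖ ≤ M := by
  obtain ⟨ρ, hρ, hball⟩ := Metric.isOpen_iff.1 hU w₀ hw₀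
  set r := ρ / 3
  have hr : 0 < r := by positivity
  have hsub : Metric.closedBall w₀ (2 * r) ⊆ U :=
    (Metric.closedBall_subset_ball (by simp only [r]; linarith)).trans hball
  obtain ⟨D, hD⟩ := (isCompact_closedBall w₀ (2 * r)).exists_bound_of_continuousOn
    ((hg.deriv hU).continuousOn.mono hsub)
  obtain ⟨G, hG⟩ := ((isCompact_closedBall w₀ (2 * r)).union hK).exists_bound_of_continuousOn
    (hg.continuousOn.mono (union_subset hsub hKU))
  have hc : w₀ ∈ Metric.closedBall w₀ (2 * r) := Metric.mem_closedBall_self (by positivity)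
  have hG0 : 0 ≤ G := (norm_nonneg _).trans (hG w₀ (Or.inl hc))
  have hb2 : Metric.ball w₀ r ⊆ Metric.closedBall w₀ (2 * r) :=
    (Metric.ball_subset_ball (by linarith)).trans Metric.ball_subset_closedBall
  refine ⟨r, max D (2 * G / r), hr, hb2.trans hsub, fun w hw t ht => ?_⟩
  by_cases htb : t ∈ Metric.closedBall w₀ (2 * r)
  · refine le_trans ?_ (le_max_left _ _)
    rcases eq_or_ne t w with rfl | hne
    · rw [dslope_same]; exact hD _ htb
    · rw [dslope_of_ne _ hne, slope_def_module, norm_smul, norm_inv,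
        inv_mul_le_iff₀ (norm_pos_iff.2 (sub_ne_zero.2 hne)), mul_comm]
      exact (convex_closedBall w₀ (2 * r)).norm_image_sub_le_of_norm_deriv_le
        (fun x hx => hg.differentiableAt (hU.mem_nhds (hsub hx))) hD (hb2 hw) htb
  · refine le_trans ?_ (le_max_right _ _)
    rw [mem_closedBall_iff_norm, not_le] at htb
    rw [mem_ball_iff_norm] at hw
    have hd : r ≤ ‖t - w‖ := by
      have := norm_sub_le (t - w) (w₀ - w)
      rw [sub_sub_sub_cancel_right, norm_sub_rev w₀ w] at this
      linarith
    have hne : t ≠ w := by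
      rintro rfl
      rw [sub_self, norm_zero] at hd
      linarith
    rw [dslope_of_ne _ hne, slope_def_module, norm_smul, norm_inv, ← div_eq_inv_mul]
    gcongr
    calc ‖g t - g w‖ ≤ ‖g t‖ + ‖g w‖ := norm_sub_le _ _
      _ ≤ G + G := add_le_add (hG t (Or.inr ht)) (hG w (Or.inl (hb2 (mem_ball_iff_norm.2 hw))))
      _ = 2 * G := by ring

namespace IsSimpleClosedContour

variable {γ : ℝ → ℂ}

theorem continuous_dslope_comp (hγ : IsSimpleClosedContour γ) {U : Set ℂ} (hU : IsOpen U)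
    (hγU : range γ ⊆ U) {g : ℂ → ℂ} (hg : DifferentiableOn ℂ g U) {w : ℂ} (hw : w ∈ U) :
    Continuous fun s => dslope g w (γ s) :=
  (((continuousOn_dslope (hU.mem_nhds hw)).2
    ⟨hg.continuousOn, hg.differentiableAt (hU.mem_nhds hw)⟩).comp_continuous hγ.continuous
      fun s => hγU (mem_range_self s))

theorem contourIntegral_dslope_of_notMem (hγ : IsSimpleClosedContour γ) {g : ℂ → ℂ}
    (hg : Continuous fun s => g (γ s)) {w : ℂ} (hw : w ∉ range γ) :
    contourIntegral γ (dslope g w) = contourIntegral γ (fun t => g t / (t - w)) -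
      g w * contourIntegral γ (fun t => 1 / (t - w)) := by
  have hne : ∀ s, γ s - w ≠ 0 := fun s h0 => hw ⟨s, sub_eq_zero.1 h0⟩
  have hsub : Continuous fun s => γ s - w := hγ.continuous.sub continuous_const
  simp only [contourIntegral]
  rw [← intervalIntegral.integral_const_mul, ← intervalIntegral.integral_sub]
  · refine intervalIntegral.integral_congr fun s _ => ?_
    simp only [dslope_of_ne _ (sub_ne_zero.1 (hne s)), slope_def_field]
    ring
  · exact hγ.hasBoundedDeriv.intervalIntegrable_mul (hg.div hsub hne).continuousOn
  · exact (hγ.hasBoundedDeriv.intervalIntegrable_mul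
      (continuous_const.div hsub hne).continuousOn).const_mul _

theorem differentiableAt_contourIntegral_div_sub (hγ : IsSimpleClosedContour γ) {g : ℂ → ℂ}
    (hg : Continuous fun s => g (γ s)) {w : ℂ} (hw : w ∉ range γ) :
    DifferentiableAt ℂ (fun w => contourIntegral γ fun t => g t / (t - w)) w := by
  obtain ⟨r, hr, hball⟩ := Metric.isOpen_iff.1 hγ.isOpen_compl_range w hw
  have hper : ∀ s, g (γ s) = g (γ (Int.fract s)) := fun s => by
    have := hγ.periodic.int_mul ⌊s⌋ (Int.fract s)
    rw [mul_one, Int.fract_add_floor] at this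
    rw [this]
  obtain ⟨B, hB⟩ := (isCompact_Icc (a := (0 : ℝ)) (b := 1)).exists_bound_of_continuousOn
    hg.continuousOn
  have hB' : ∀ s, ‖g (γ s)‖ ≤ B := fun s => by
    rw [hper]; exact hB _ ⟨Int.fract_nonneg s, (Int.fract_lt_one s).le⟩
  have hB0 : 0 ≤ B := (norm_nonneg _).trans (hB' 0)
  have hdist : ∀ x ∈ Metric.ball w (r / 2), ∀ s, r / 2 ≤ ‖γ s - x‖ := by
    intro x hx s
    by_contra! hlt
    rw [mem_ball_iff_norm] at hx
    refine hball (mem_ball_iff_norm.2 ?_) (mem_range_self s)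
    calc ‖γ s - w‖ = ‖(γ s - x) + (x - w)‖ := by ring_nf
      _ ≤ ‖γ s - x‖ + ‖x - w‖ := norm_add_le _ _
      _ < r := by linarith
  have hne : ∀ x ∈ Metric.ball w (r / 2), ∀ s, γ s - x ≠ 0 := fun x hx s h0 => by
    have := hdist x hx s
    rw [h0, norm_zero] at this
    linarith
  refine hγ.hasBoundedDeriv.differentiableAt_integral_mul_deriv
    (Φ := fun w s => g (γ s) / (γ s - w)) (M := B / (r / 2)) (half_pos hr) ?_ ?_ ?_
  · intro s x hx
    exact ((differentiableAt_const _).div ((differentiableAt_const _).sub differentiableAt_id)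
      (hne x hx s)).differentiableWithinAt
  · exact fun x hx => hg.div (hγ.continuous.sub continuous_const) (hne x hx)
  · intro x hx s
    rw [norm_div]
    gcongr
    · exact hB' s
    · exact hdist x hx s

theorem differentiableAt_contourIntegral_dslope (hγ : IsSimpleClosedContour γ) {U : Set ℂ}
    (hU : IsOpen U) (hγU : range γ ⊆ U) {g : ℂ → ℂ} (hg : DifferentiableOn ℂ g U) {w : ℂ}
    (hw : w ∈ U) : DifferentiableAt ℂ (fun w => contourIntegral γ (dslope g w)) w := by
  obtain ⟨r, M, hr, hball, hM⟩ := exists_norm_dslope_le hU hg hγ.isCompact_range hγU hw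
  refine hγ.hasBoundedDeriv.differentiableAt_integral_mul_deriv
    (Φ := fun w s => dslope g w (γ s)) hr ?_ ?_ fun x hx s => hM x hx _ (mem_range_self s)
  · intro s
    simp only [fun x => dslope_comm (g := g) x (γ s)]
    exact ((Complex.differentiableOn_dslope
      (hU.mem_nhds (hγU (mem_range_self s)))).2 hg).mono hball
  · exact fun x hx => hγ.continuous_dslope_comp hU hγU hg (hball hx)

/-- Cauchy's theorem for a contour and a function holomorphic on a neighbourhood of the closed
domain which it bounds. -/
theorem contourIntegral_dslope_eq_zero (hγ : IsSimpleClosedContour γ) {U : Set ℂ}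
    (hU : IsOpen U) (hKU : insideDomain γ ∪ range γ ⊆ U) {g : ℂ → ℂ}
    (hg : DifferentiableOn ℂ g U) :
    (∀ w ∈ U, contourIntegral γ (dslope g w) = 0) ∧
      ∀ w ∈ outsideDomain γ, contourIntegral γ (fun t => g t / (t - w)) = 0 := by
  classical
  have hγU : range γ ⊆ U := subset_union_right.trans hKU
  have hgγ : Continuous fun s => g (γ s) :=
    hg.continuousOn.comp_continuous hγ.continuous fun s => hγU (mem_range_self s)
  set H : ℂ → ℂ := fun w => if w ∈ outsideDomain γ then contourIntegral γ (fun t => g t / (t - w))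
    else contourIntegral γ (dslope g w)
  have hHo : ∀ w ∈ outsideDomain γ, H w = contourIntegral γ (fun t => g t / (t - w)) :=
    fun w hw => if_pos hw
  -- This holds even where `w ∉ U`: off the curve `dslope g w t` is a plain difference quotient, and
  -- the term `g w` is multiplied by a vanishing winding integral.
  have hHU : ∀ w, H w = contourIntegral γ (dslope g w) := by
    intro w
    by_cases hw : w ∈ outsideDomain γ
    · rw [hHo w hw, hγ.contourIntegral_dslope_of_notMem hgγ hw.1,
        hγ.contourIntegral_inv_eq_zero hw, mul_zero, sub_zero]
    · exact if_neg hw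
  have hdiff : Differentiable ℂ H := by
    intro w
    by_cases hw : w ∈ outsideDomain γ
    · refine (hγ.differentiableAt_contourIntegral_div_sub hgγ hw.1).congr_of_eventuallyEq ?_
      filter_upwards [hγ.isOpen_outsideDomain.mem_nhds hw] with x hx using hHo x hx
    · have hwU : w ∈ U := hKU (by rw [insideDomain_union_range]; exact hw)
      exact (hγ.differentiableAt_contourIntegral_dslope hU hγU hg hwU).congr_of_eventuallyEq
        (Eventually.of_forall hHU)
  have hlim : Tendsto H (cocompact ℂ) (𝓝 0) := by
    refine (hγ.tendsto_contourIntegral_div_sub hgγ).congr' ?_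
    obtain ⟨R, hR, h⟩ := hγ.exists_norm_lt
    filter_upwards [(tendsto_norm_cocompact_atTop (E := ℂ)).eventually_gt_atTop R] with w hw
    exact (hHo w (mem_outsideDomain_of_norm_lt hR h hw)).symm
  have h0 : ∀ w, H w = 0 := fun w => hdiff.apply_eq_of_tendsto_cocompact w hlim
  exact ⟨fun w _ => by rw [← hHU, h0], fun w hw => by rw [← hHo w hw, h0]⟩

end IsSimpleClosedContour

/-! ### Local analysis at a smooth point -/

/-- The integrand of `∫ dt / t` along `β`, cut off at distance `ε` from the origin. -/
noncomputable def truncatedKernel (β : ℝ → ℂ) (ε s : ℝ) : ℂ :=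
  {s | ε < ‖β s‖}.indicator (fun s => (β s)⁻¹ * deriv β s) s

theorem truncatedKernel_of_lt {β : ℝ → ℂ} {ε s : ℝ} (h : ε < ‖β s‖) :
    truncatedKernel β ε s = (β s)⁻¹ * deriv β s :=
  indicator_of_mem (s := {s | ε < ‖β s‖}) h _

theorem truncatedKernel_of_le {β : ℝ → ℂ} {ε s : ℝ} (h : ‖β s‖ ≤ ε) :
    truncatedKernel β ε s = 0 :=
  indicator_of_notMem (s := {s | ε < ‖β s‖}) (not_lt.2 h) _

theorem exists_norm_sub_le_of_hasDerivWithinAt {β : ℝ → ℂ} (h0 : β 0 = 0) {r : ℝ}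
    (hd : HasDerivWithinAt β r (Ici 0) 0) {δ κ : ℝ} (hδ : 0 < δ) (hκ : 0 < κ) :
    ∃ δ₁, 0 < δ₁ ∧ δ₁ < δ ∧ ∀ s ∈ Ioc 0 δ₁, ‖β s - r * s‖ ≤ κ * s := by
  have := hd.isLittleO.def hκ
  rw [eventually_iff, mem_nhdsGE_iff_exists_Icc_subset] at this
  obtain ⟨u, hu, hsub⟩ := this
  refine ⟨min u (δ / 2), lt_min hu (by positivity),
    (min_le_right _ _).trans_lt (by linarith), fun s hs => ?_⟩
  have h1 := hsub ⟨hs.1.le, hs.2.trans (min_le_left _ _)⟩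
  simp only [mem_ofPred_eq, h0, sub_zero, Complex.real_smul, Real.norm_eq_abs,
    abs_of_pos hs.1] at h1
  rwa [mul_comm (s : ℂ)] at h1

theorem exists_re_pos_of_hasDerivWithinAt {β : ℝ → ℂ} (h0 : β 0 = 0) {r : ℝ} (hr : 0 < r)
    (hd : HasDerivWithinAt β r (Ici 0) 0) {a : ℝ} (ha : 0 < a) :
    ∃ δ, 0 < δ ∧ δ < a ∧ ∀ s ∈ Ioc 0 δ, 0 < (β s).re := by
  obtain ⟨δ, hδ, hδa, h⟩ := exists_norm_sub_le_of_hasDerivWithinAt h0 hd ha (half_pos hr)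
  refine ⟨δ, hδ, hδa, fun s hs => ?_⟩
  have h1 := (Complex.abs_re_le_norm _).trans (h s hs)
  simp only [Complex.sub_re, ← Complex.ofReal_mul, Complex.ofReal_re] at h1
  have := (abs_le.1 h1).1
  nlinarith [hs.1, mul_pos hr hs.1]

namespace HasBoundedDeriv

variable {β : ℝ → ℂ}

theorem intervalIntegrable_truncatedKernel (h : HasBoundedDeriv β) {ε : ℝ} (hε : 0 < ε)
    (a b : ℝ) : IntervalIntegrable (truncatedKernel β ε) volume a b := by
  obtain ⟨M, hM⟩ := h.bounded
  refine (intervalIntegrable_const (c := ε⁻¹ * M)).mono_fun ?_ (ae_of_all _ fun s => ?_)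
  · exact ((h.continuous.measurable.inv.mul (measurable_deriv β)).indicator
      (measurableSet_lt measurable_const h.continuous.measurable.norm)).aestronglyMeasurable
  · have hM0 : 0 ≤ M := (norm_nonneg _).trans (hM 0)
    refine le_trans ?_ (le_abs_self _)
    simp only [truncatedKernel, indicator_apply, mem_ofPred_eq]
    split_ifs with hs
    · rw [norm_mul, norm_inv]
      gcongr
      exact hM s
    · rw [norm_zero]; positivity

/-- The two ways of cutting off a one-sided neighbourhood, by the distance on the curve and by
the parameter, are asymptotically equivalent. -/
theorem tendsto_integral_truncatedKernel_sub (h : HasBoundedDeriv β) (h0 : β 0 = 0) {r : ℝ}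
    (hr : 0 < r) (hd : HasDerivWithinAt β r (Ici 0) 0) {δ : ℝ} (hδ : 0 < δ)
    (hre : ∀ s ∈ Ioc 0 δ, 0 < (β s).re) :
    Tendsto (fun ε : ℝ => (∫ s in 0..δ, truncatedKernel β ε s) -
      ∫ s in (ε / r)..δ, (β s)⁻¹ * deriv β s) (𝓝[>] 0) (𝓝 0) := by
  obtain ⟨M, hM⟩ := h.bounded
  have hM0 : 0 ≤ M := (norm_nonneg _).trans (hM 0)
  have hne : ∀ s ∈ Ioc 0 δ, β s ≠ 0 := fun s hs h0 => by
    have := hre s hs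
    rw [h0, Complex.zero_re] at this
    exact lt_irrefl _ this
  -- If `|β s - r s| ≤ κ s`, the two cutoffs differ only for `s` between `ε/(r + κ)` and `ε/(r -
  -- κ)`. There the integrand is at most `M(r + κ)/((r - κ)ε)`; multiplied by the length of the
  -- interval, this gives a bound free of `ε`, which tends to `0` with `κ`.
  have key : ∀ κ, 0 < κ → κ < r → ∀ᶠ ε in 𝓝[>] (0 : ℝ),
      ‖(∫ s in 0..δ, truncatedKernel β ε s) - ∫ s in (ε / r)..δ, (β s)⁻¹ * deriv β s‖
        ≤ M * (2 * κ) / (r - κ) ^ 2 := by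
    intro κ hκ hκr
    obtain ⟨δ₁, hδ₁, hδ₁δ, hlin⟩ := exists_norm_sub_le_of_hasDerivWithinAt h0 hd hδ hκ
    -- Beyond `δ₁` the curve stays away from the origin, so neither cutoff acts there once `ε` is
    -- small.
    obtain ⟨c, hc, hcb⟩ : ∃ c, 0 < c ∧ ∀ s ∈ Icc δ₁ δ, c < ‖β s‖ := by
      obtain ⟨s₀, hs₀, hmin⟩ := (isCompact_Icc (a := δ₁) (b := δ)).exists_isMinOn
        ⟨δ₁, le_rfl, hδ₁δ.le⟩ h.continuous.norm.continuousOn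
      have hp : 0 < ‖β s₀‖ := norm_pos_iff.2 (hne s₀ ⟨hδ₁.trans_le hs₀.1, hs₀.2⟩)
      exact ⟨‖β s₀‖ / 2, by positivity, fun s hs =>
        (half_lt_self hp).trans_le (isMinOn_iff.1 hmin s hs)⟩
    have hrκ : 0 < r - κ := by linarith
    have hpos : ∀ᶠ ε in 𝓝[>] (0 : ℝ), 0 < ε := eventually_mem_nhdsWithin
    have hsm : ∀ᶠ ε in 𝓝[>] (0 : ℝ), ε < min c (r * δ₁) :=
      nhdsWithin_le_nhds (eventually_lt_nhds (lt_min hc (by positivity)))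
    filter_upwards [hpos, hsm] with ε hε hεs
    have hεc := hεs.trans_le (min_le_left _ _)
    have hερ : ε / r < δ₁ := by
      rw [div_lt_iff₀ hr, mul_comm]
      exact hεs.trans_le (min_le_right _ _)
    have hρ : 0 < ε / r := by positivity
    set f : ℝ → ℂ := fun s => (β s)⁻¹ * deriv β s
    set l := ε / (r + κ)
    set u := ε / (r - κ)
    have hlu : l ≤ u := div_le_div_of_nonneg_left hε.le hrκ (by linarith)
    have hfi : IntervalIntegrable f volume (ε / r) δ := by
      refine h.intervalIntegrable_mul (h.continuous.continuousOn.inv₀ fun s hs => ?_)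
      rw [uIcc_of_le (by linarith)] at hs
      exact hne s ⟨hρ.trans_le hs.1, hs.2⟩
    have e1 : ∫ s in 0..δ, truncatedKernel β ε s =
        ∫ s, (Ioc 0 δ).indicator (truncatedKernel β ε) s := by
      rw [intervalIntegral.integral_of_le hδ.le, integral_indicator measurableSet_Ioc]
    have e2 : ∫ s in (ε / r)..δ, f s = ∫ s, (Ioc (ε / r) δ).indicator f s := by
      rw [intervalIntegral.integral_of_le (by linarith), integral_indicator measurableSet_Ioc]
    rw [e1, e2, ← integral_sub]
    rotate_left
    · rw [integrable_indicator_iff measurableSet_Ioc, ← intervalIntegrable_iff_integrableOn_Ioc_of_le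
        hδ.le]
      exact h.intervalIntegrable_truncatedKernel hε _ _
    · rwa [integrable_indicator_iff measurableSet_Ioc,
        ← intervalIntegrable_iff_integrableOn_Ioc_of_le (by linarith)]
    have hbound : ∀ s, ‖(Ioc 0 δ).indicator (truncatedKernel β ε) s -
        (Ioc (ε / r) δ).indicator f s‖ ≤
          (Icc l u).indicator (fun _ => M * (r + κ) / ((r - κ) * ε)) s := by
      intro s
      have hC : 0 ≤ M * (r + κ) / ((r - κ) * ε) := by positivity
      have hnn : 0 ≤ (Icc l u).indicator (fun _ => M * (r + κ) / ((r - κ) * ε)) s :=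
        indicator_nonneg (fun _ _ => hC) s
      by_cases hs : s ∈ Ioc 0 δ
      swap
      · have hs' : s ∉ Ioc (ε / r) δ := fun h' => hs ⟨hρ.trans h'.1, h'.2⟩
        rw [indicator_of_notMem hs, indicator_of_notMem hs', sub_zero, norm_zero]
        exact hnn
      rw [indicator_of_mem hs]
      by_cases hs1 : s ≤ δ₁
      swap
      · push Not at hs1
        rw [indicator_of_mem (s := Ioc (ε / r) δ) ⟨hερ.trans hs1, hs.2⟩,
          truncatedKernel_of_lt (hεc.trans (hcb s ⟨hs1.le, hs.2⟩)), sub_self, norm_zero]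
        exact hnn
      have hl := hlin s ⟨hs.1, hs1⟩
      have hrs : ‖(r : ℂ) * s‖ = r * s := by
        rw [← Complex.ofReal_mul, Complex.norm_real, Real.norm_of_nonneg
          (mul_nonneg hr.le hs.1.le)]
      have hup : ‖β s‖ ≤ (r + κ) * s := by
        have := norm_sub_norm_le (β s) (r * s)
        rw [hrs] at this; linarith
      have hlo : (r - κ) * s ≤ ‖β s‖ := by
        have := norm_sub_norm_le ((r : ℂ) * s) (β s)
        rw [hrs, norm_sub_rev] at this; linarith
      have hf : s ∈ Icc l u → ‖f s‖ ≤ M * (r + κ) / ((r - κ) * ε) := by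
        intro hsm
        have h1 : ε ≤ s * (r + κ) := (div_le_iff₀ (by positivity)).1 hsm.1
        simp only [f]
        rw [norm_mul, norm_inv, inv_mul_le_iff₀ (norm_pos_iff.2 (hne s hs))]
        have h2 : M ≤ (r - κ) * s * (M * (r + κ) / ((r - κ) * ε)) := by
          rw [mul_div_assoc', le_div_iff₀ (by positivity)]
          nlinarith [mul_nonneg hM0 hrκ.le, mul_le_mul_of_nonneg_left h1 (mul_nonneg hM0 hrκ.le)]
        exact ((hM s).trans h2).trans (mul_le_mul_of_nonneg_right hlo hC)
      by_cases hA : ε < ‖β s‖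
      · by_cases hB : ε / r < s
        · rw [indicator_of_mem (s := Ioc (ε / r) δ) ⟨hB, hs.2⟩,
            truncatedKernel_of_lt hA, sub_self, norm_zero]
          exact hnn
        · have hm : s ∈ Icc l u := by
            push Not at hB
            refine ⟨(div_le_iff₀ (by positivity)).2 (by linarith), hB.trans ?_⟩
            exact div_le_div_of_nonneg_left hε.le hrκ (by linarith)
          rw [indicator_of_notMem (s := Ioc (ε / r) δ) (fun h' => hB h'.1),
            truncatedKernel_of_lt hA, sub_zero, indicator_of_mem hm]
          exact hf hm
      · by_cases hB : ε / r < s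
        · have hm : s ∈ Icc l u := by
            push Not at hA
            refine ⟨le_trans ?_ hB.le, (le_div_iff₀ hrκ).2 (by linarith)⟩
            exact div_le_div_of_nonneg_left hε.le hr (by linarith)
          rw [indicator_of_mem (s := Ioc (ε / r) δ) ⟨hB, hs.2⟩,
            truncatedKernel_of_le (not_lt.1 hA), zero_sub, norm_neg, indicator_of_mem hm]
          exact hf hm
        · rw [indicator_of_notMem (s := Ioc (ε / r) δ) (fun h' => hB h'.1),
            truncatedKernel_of_le (not_lt.1 hA), sub_zero, norm_zero]
          exact hnn
    refine (norm_integral_le_of_norm_le ?_ (ae_of_all _ hbound)).trans (le_of_eq ?_)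
    · rw [integrable_indicator_iff measurableSet_Icc]
      exact integrableOn_const (by simp)
    · rw [integral_indicator measurableSet_Icc, setIntegral_const, Measure.real, Real.volume_Icc,
        ENNReal.toReal_ofReal (by linarith), smul_eq_mul]
      have : r + κ ≠ 0 := by positivity
      simp only [l, u]
      field_simp
      ring
  rw [Metric.tendsto_nhds]
  intro e he
  have hlim : Tendsto (fun κ : ℝ => M * (2 * κ) / (r - κ) ^ 2) (𝓝[>] 0) (𝓝 0) := by
    have hc : ContinuousAt (fun κ : ℝ => M * (2 * κ) / (r - κ) ^ 2) 0 := by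
      have : (r - 0) ^ 2 ≠ 0 := by rw [sub_zero]; positivity
      fun_prop (disch := assumption)
    simpa using hc.tendsto.mono_left nhdsWithin_le_nhds
  obtain ⟨κ, h1, h2, h3⟩ := ((hlim.eventually (gt_mem_nhds he)).and
    ((eventually_mem_nhdsWithin (s := Ioi (0 : ℝ))).and
      (nhdsWithin_le_nhds (eventually_lt_nhds hr)))).exists
  filter_upwards [key κ h2 h3] with ε hε
  rw [dist_zero_right]
  exact hε.trans_lt h1

/-- The integral from `ε/r` to `δ` is `log β(δ) - log β(ε/r)`, and `β(ε/r)/ε → 1`. Cutting at `ε/r`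
absorbs the speed `r`, so the divergence is the same for every branch. -/
theorem tendsto_integral_truncatedKernel_add_log (h : HasBoundedDeriv β) (h0 : β 0 = 0) {r : ℝ}
    (hr : 0 < r) (hd : HasDerivWithinAt β r (Ici 0) 0) {δ : ℝ} (hδ : 0 < δ)
    (hre : ∀ s ∈ Ioc 0 δ, 0 < (β s).re) :
    Tendsto (fun ε : ℝ => (∫ s in 0..δ, truncatedKernel β ε s) + Real.log ε) (𝓝[>] 0)
      (𝓝 (Complex.log (β δ))) := by
  have hslope : Tendsto (fun ε : ℝ => ((ε⁻¹ : ℝ) : ℂ) * β (ε / r)) (𝓝[>] 0) (𝓝 1) := by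
    have h1 := (hasDerivWithinAt_iff_tendsto_slope' self_notMem_Ioi).1
      (hd.mono Ioi_subset_Ici_self)
    have h2 : Tendsto (fun ε : ℝ => ε / r) (𝓝[>] 0) (𝓝[>] 0) := by
      refine tendsto_nhdsWithin_iff.2 ⟨?_, ?_⟩
      · have : Tendsto (fun ε : ℝ => ε / r) (𝓝 0) (𝓝 (0 / r)) := tendsto_id.div_const r
        rw [zero_div] at this
        exact this.mono_left nhdsWithin_le_nhds
      · filter_upwards [eventually_mem_nhdsWithin] with ε hε
        exact div_pos hε hr
    have h3 := (h1.comp h2).const_mul ((r : ℂ)⁻¹)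
    have hrc : (r : ℂ) ≠ 0 := by exact_mod_cast hr.ne'
    rw [inv_mul_cancel₀ hrc] at h3
    refine h3.congr' ?_
    filter_upwards [eventually_mem_nhdsWithin] with ε hε
    have : (ε : ℂ) ≠ 0 := by exact_mod_cast (ne_of_gt hε)
    simp only [Function.comp, slope_def_module, h0, sub_zero, Complex.real_smul]
    push_cast
    field_simp
  have hlog := (continuousAt_clog (x := 1) Complex.one_mem_slitPlane).tendsto.comp hslope
  have hsub := h.tendsto_integral_truncatedKernel_sub h0 hr hd hδ hre
  have := (hsub.add_const (Complex.log (β δ))).sub hlog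
  rw [Complex.log_one, zero_add, sub_zero] at this
  refine this.congr' ?_
  have hpos : ∀ᶠ ε in 𝓝[>] (0 : ℝ), 0 < ε := eventually_mem_nhdsWithin
  have hsm : ∀ᶠ ε in 𝓝[>] (0 : ℝ), ε < r * δ :=
    nhdsWithin_le_nhds (eventually_lt_nhds (by positivity))
  filter_upwards [hpos, hsm] with ε hε hεδ
  have hρ : 0 < ε / r := by positivity
  have hρδ : ε / r ≤ δ := ((div_lt_iff₀ hr).2 (by linarith)).le
  have hint := h.integral_inv_sub_mul_deriv hρδ (w := 0) (u := 1) fun s hs => by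
    rw [one_mul, sub_zero]
    exact Or.inl (hre s ⟨hρ.trans_le hs.1, hs.2⟩)
  simp only [sub_zero, one_mul] at hint
  have hne : β (ε / r) ≠ 0 := fun h' => by
    have := hre _ ⟨hρ, hρδ⟩
    rw [h', Complex.zero_re] at this
    exact lt_irrefl _ this
  rw [hint, Function.comp, Complex.log_ofReal_mul (inv_pos.2 hε) hne, Real.log_inv]
  push_cast
  ring

end HasBoundedDeriv

/-- In the right half-plane a quarter turn in either direction does not cross the cut. This is the
source of the jump. -/
theorem Complex.log_sign_mul_I_mul {σ : ℝ} (hσ : σ = 1 ∨ σ = -1) {x : ℂ} (hx : 0 < x.re) :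
    Complex.log (σ * Complex.I * x) = Complex.log x + σ * (Real.pi / 2) * Complex.I := by
  have hx0 : x ≠ 0 := by rintro rfl; exact lt_irrefl _ hx
  have harg := abs_lt.1 (Complex.abs_arg_lt_pi_div_two_iff.2 (Or.inl hx))
  rcases hσ with rfl | rfl
  · rw [Complex.ofReal_one, one_mul, Complex.log_mul Complex.I_ne_zero hx0, Complex.log_I]
    · ring
    · rw [Complex.arg_I]
      constructor <;> linarith
  · rw [Complex.ofReal_neg, Complex.ofReal_one, neg_one_mul,
      Complex.log_mul (neg_ne_zero.2 Complex.I_ne_zero) hx0, Complex.log_neg_I]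
    · ring
    · rw [Complex.arg_neg_I]
      constructor <;> linarith

namespace HasBoundedDeriv

variable {β γ : ℝ → ℂ}

theorem deriv_affine (γ : ℝ → ℂ) (c z : ℂ) (s₀ σ s : ℝ) :
    deriv (fun s => c * (γ (s₀ + σ * s) - z)) s = c * (σ * deriv γ (s₀ + σ * s)) := by
  rw [deriv_const_mul_field, deriv_sub_const_fun,
    deriv_comp_mul_left σ (fun x => γ (s₀ + x)) s, deriv_comp_const_add, Complex.real_smul]

theorem affine (h : HasBoundedDeriv γ) (c z : ℂ) (s₀ : ℝ) {σ : ℝ} (hσ : σ ≠ 0) :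
    HasBoundedDeriv fun s => c * (γ (s₀ + σ * s) - z) := by
  obtain ⟨E, hE, hd⟩ := h.differentiableAt
  obtain ⟨M, hM⟩ := h.bounded
  have hc := h.continuous
  refine ⟨by fun_prop, ⟨(fun s => s₀ + σ * s) ⁻¹' E, ?_, ?_⟩, ‖c‖ * (‖(σ : ℂ)‖ * M), ?_⟩
  · exact hE.preimage_of_injOn fun x _ y _ hxy => mul_left_cancel₀ hσ (add_left_cancel hxy)
  · intro s hs
    have h1 : DifferentiableAt ℝ (fun s : ℝ => s₀ + σ * s) s := by fun_prop
    exact (((hd _ hs).comp s h1).sub_const z).const_mul c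
  · intro s
    rw [deriv_affine, norm_mul, norm_mul]
    gcongr
    exact hM _

theorem eventually_integral_truncatedKernel_eq (h : HasBoundedDeriv β) {p q : ℝ} (hpq : p ≤ q)
    (hne : ∀ s ∈ Icc p q, β s ≠ 0) :
    ∀ᶠ ε : ℝ in 𝓝[>] 0,
      ∫ s in p..q, truncatedKernel β ε s = ∫ s in p..q, (β s)⁻¹ * deriv β s := by
  obtain ⟨s₀, hs₀, hmin⟩ := (isCompact_Icc (a := p) (b := q)).exists_isMinOn
    ⟨p, le_rfl, hpq⟩ h.continuous.norm.continuousOn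
  filter_upwards [nhdsWithin_le_nhds (eventually_lt_nhds (norm_pos_iff.2 (hne s₀ hs₀)))]
    with ε hε
  refine intervalIntegral.integral_congr fun s hs => ?_
  rw [uIcc_of_le hpq] at hs
  exact truncatedKernel_of_lt (hε.trans_le (isMinOn_iff.1 hmin s hs))

theorem eventually_forall_ne (h : HasBoundedDeriv β) {p q : ℝ}
    (hne : ∀ s ∈ Icc p q, β s ≠ 0) : ∀ᶠ w in 𝓝 (0 : ℂ), ∀ s ∈ Icc p q, β s ≠ w := by
  have hK : IsCompact (β '' Icc p q) := isCompact_Icc.image h.continuous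
  have h0 : (0 : ℂ) ∈ (β '' Icc p q)ᶜ := fun ⟨s, hs, hs0⟩ => hne s hs hs0
  filter_upwards [hK.isClosed.isOpen_compl.mem_nhds h0] with w hw s hs hsw
  exact hw ⟨s, hs, hsw⟩

theorem tendsto_integral_inv_sub (h : HasBoundedDeriv β) {p q : ℝ} (hpq : p ≤ q)
    (hne : ∀ s ∈ Icc p q, β s ≠ 0) :
    Tendsto (fun w => ∫ s in p..q, (β s - w)⁻¹ * deriv β s) (𝓝 0)
      (𝓝 (∫ s in p..q, (β s)⁻¹ * deriv β s)) := by
  obtain ⟨s₀, hs₀, hmin⟩ := (isCompact_Icc (a := p) (b := q)).exists_isMinOn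
    ⟨p, le_rfl, hpq⟩ h.continuous.norm.continuousOn
  have hc : 0 < ‖β s₀‖ := norm_pos_iff.2 (hne s₀ hs₀)
  obtain ⟨M, hM⟩ := h.bounded
  refine intervalIntegral.tendsto_integral_filter_of_dominated_convergence
    (fun _ => (‖β s₀‖ / 2)⁻¹ * M) ?_ ?_ intervalIntegrable_const ?_
  · refine Eventually.of_forall fun w => Measurable.aestronglyMeasurable ?_
    exact ((h.continuous.sub continuous_const).measurable.inv).mul (measurable_deriv β)
  · filter_upwards [Metric.ball_mem_nhds (0 : ℂ) (half_pos hc)] with w hw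
    refine ae_of_all _ fun s hs => ?_
    rw [uIoc_of_le hpq] at hs
    rw [mem_ball_zero_iff] at hw
    rw [norm_mul, norm_inv]
    gcongr
    · have h1 := isMinOn_iff.1 hmin s (Ioc_subset_Icc_self hs)
      have h2 := norm_sub_norm_le (β s) w
      linarith
    · exact hM s
  · refine ae_of_all _ fun s hs => ?_
    rw [uIoc_of_le hpq] at hs
    have h1 : Tendsto (fun w => β s - w) (𝓝 0) (𝓝 (β s)) := by
      simpa using (tendsto_const_nhds (x := β s)).sub (tendsto_id (α := ℂ) (x := 𝓝 0))
    exact (h1.inv₀ (hne s (Ioc_subset_Icc_self hs))).mul_const _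

theorem intervalIntegrable_inv_sub (h : HasBoundedDeriv β) {p q : ℝ} (hpq : p ≤ q) {w : ℂ}
    (hne : ∀ s ∈ Icc p q, β s ≠ w) :
    IntervalIntegrable (fun s => (β s - w)⁻¹ * deriv β s) volume p q := by
  refine h.intervalIntegrable_mul ((h.continuous.sub continuous_const).continuousOn.inv₀ ?_)
  rw [uIcc_of_le hpq]
  exact fun s hs => sub_ne_zero.2 (hne s hs)

/-- At a smooth point the principal value of `∫ dt / t` exists, and the integrals
`∫ dt / (t - w)` tend to it, up to a jump of `±πi`, as `w` approaches the point along the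
normal. -/
theorem exists_tendsto_principalValue (h : HasBoundedDeriv β) (h0 : β 0 = 0) {r₁ r₂ : ℝ}
    (hr₁ : 0 < r₁) (hr₂ : 0 < r₂) (hd₁ : HasDerivWithinAt β r₁ (Ici 0) 0)
    (hd₂ : HasDerivWithinAt β r₂ (Iic 0) 0) {a : ℝ} (ha : 0 < a)
    (hne : ∀ s ∈ Icc (-a) a, s ≠ 0 → β s ≠ 0) :
    ∃ L : ℂ, Tendsto (fun ε => ∫ s in (-a)..a, truncatedKernel β ε s) (𝓝[>] 0) (𝓝 L) ∧
      ∀ σ : ℝ, σ = 1 ∨ σ = -1 →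
        Tendsto (fun η : ℝ => ∫ s in (-a)..a, (β s - σ * η * Complex.I)⁻¹ * deriv β s)
          (𝓝[>] 0) (𝓝 (L + σ * Real.pi * Complex.I)) ∧
        ∀ᶠ η : ℝ in 𝓝[>] 0, ∀ s ∈ Icc (-a) a, β s ≠ σ * η * Complex.I := by
  -- Reversing the parameter and rotating by `π` makes the left branch leave the origin along the
  -- positive reals, so the one-sided results apply to it. The affine form matches
  -- `HasBoundedDeriv.affine`.
  set α : ℝ → ℂ := fun s => -1 * (β (0 + -1 * s) - 0) with hα
  have hαβ : ∀ s, α s = -β (-s) := fun s => by simp [hα]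
  have hαd : ∀ s, deriv α s = deriv β (-s) := fun s => by
    rw [hα, deriv_affine]; simp
  have hαb : HasBoundedDeriv α := h.affine (-1) 0 0 (by norm_num)
  have hα0 : α 0 = 0 := by rw [hαβ, neg_zero, h0, neg_zero]
  have hαd0 : HasDerivWithinAt α r₂ (Ici 0) 0 := by
    have h1 : HasDerivWithinAt β r₂ (Iic 0) (-0) := by rwa [neg_zero]
    have h2 := (h1.scomp (0 : ℝ) (hasDerivWithinAt_neg (0 : ℝ) (Ici 0))
      fun x hx => by simpa using hx).neg
    simp only [neg_smul, one_smul, neg_neg] at h2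
    exact h2.congr (fun x _ => hαβ x) (hαβ 0)
  obtain ⟨δ₁, hδ₁, hδ₁a, hre₁⟩ := exists_re_pos_of_hasDerivWithinAt h0 hr₁ hd₁ ha
  obtain ⟨δ₂, hδ₂, hδ₂a, hre₂⟩ := exists_re_pos_of_hasDerivWithinAt hα0 hr₂ hαd0 ha
  set δ := min δ₁ δ₂
  have hδ : 0 < δ := lt_min hδ₁ hδ₂
  have hδa : δ < a := (min_le_left _ _).trans_lt hδ₁a
  have hβre : ∀ s ∈ Ioc 0 δ, 0 < (β s).re := fun s hs =>
    hre₁ s ⟨hs.1, hs.2.trans (min_le_left _ _)⟩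
  have hαre : ∀ s ∈ Ioc 0 δ, 0 < (α s).re := fun s hs =>
    hre₂ s ⟨hs.1, hs.2.trans (min_le_right _ _)⟩
  have hβre' : ∀ s ∈ Ico (-δ) 0, (β s).re < 0 := fun s hs => by
    have := hαre (-s) ⟨neg_pos.2 hs.2, by linarith [hs.1]⟩
    rw [hαβ, neg_neg, Complex.neg_re] at this
    linarith
  have hout₁ : ∀ s ∈ Icc δ a, β s ≠ 0 := fun s hs =>
    hne s ⟨by linarith [hs.1], hs.2⟩ (by linarith [hs.1])
  have hout₂ : ∀ s ∈ Icc (-a) (-δ), β s ≠ 0 := fun s hs =>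
    hne s ⟨hs.1, by linarith [hs.2]⟩ (by linarith [hs.2])
  set O₁ := ∫ s in δ..a, (β s)⁻¹ * deriv β s
  set O₂ := ∫ s in (-a)..(-δ), (β s)⁻¹ * deriv β s
  -- The outer arcs contribute `O₁` and `O₂`; subtracting the two one-sided limits removes `log ε`.
  refine ⟨O₂ + (Complex.log (β δ) - Complex.log (α δ)) + O₁, ?_, ?_⟩
  · have hR := (h.tendsto_integral_truncatedKernel_add_log h0 hr₁ hd₁ hδ hβre).sub
      (hαb.tendsto_integral_truncatedKernel_add_log hα0 hr₂ hαd0 hδ hαre)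
    refine ((hR.const_add O₂).add_const O₁).congr' ?_
    have hpos : ∀ᶠ ε in 𝓝[>] (0 : ℝ), 0 < ε := eventually_mem_nhdsWithin
    filter_upwards [hpos, h.eventually_integral_truncatedKernel_eq hδa.le hout₁,
      h.eventually_integral_truncatedKernel_eq (neg_le_neg hδa.le) hout₂] with ε hε h1 h2
    have hi := h.intervalIntegrable_truncatedKernel hε
    rw [← intervalIntegral.integral_add_adjacent_intervals (hi (-a) δ) (hi δ a),
      ← intervalIntegral.integral_add_adjacent_intervals (hi (-a) (-δ)) (hi (-δ) δ),
      ← intervalIntegral.integral_add_adjacent_intervals (hi (-δ) 0) (hi 0 δ), h1, h2]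
    have hrefl : ∫ s in 0..δ, truncatedKernel α ε s = -∫ s in (-δ)..0, truncatedKernel β ε s := by
      have h3 : ∀ s, truncatedKernel α ε s = -truncatedKernel β ε (-s) := by
        intro s
        have hn : ‖α s‖ = ‖β (-s)‖ := by rw [hαβ, norm_neg]
        rcases lt_or_ge ε ‖β (-s)‖ with h4 | h4
        · rw [truncatedKernel_of_lt h4, truncatedKernel_of_lt (hn ▸ h4), hαd, hαβ, inv_neg,
            neg_mul]
        · rw [truncatedKernel_of_le h4, truncatedKernel_of_le (hn ▸ h4), neg_zero]
      simp only [h3, intervalIntegral.integral_neg]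
      rw [intervalIntegral.integral_comp_neg (fun s => truncatedKernel β ε s), neg_zero]
    rw [hrefl]
    ring
  · intro σ hσ
    have hσ2 : (σ : ℂ) * σ = 1 := by rcases hσ with rfl | rfl <;> norm_num
    have hσabs : σ ≠ 0 := by rcases hσ with rfl | rfl <;> norm_num
    have hw : Tendsto (fun η : ℝ => (σ : ℂ) * η * Complex.I) (𝓝[>] 0) (𝓝 0) := by
      have hc : Continuous fun η : ℝ => (σ : ℂ) * η * Complex.I := by fun_prop
      simpa using (hc.tendsto 0).mono_left nhdsWithin_le_nhds
    have hu : ∀ (η : ℝ) (x : ℂ),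
        σ * Complex.I * (x - σ * η * Complex.I) = σ * Complex.I * x + η := by
      intro η x
      linear_combination (-(η : ℂ) * σ * σ) * Complex.I_mul_I + (η : ℂ) * hσ2
    -- After the rotation by `σi` the imaginary part is `σ Re (β s)`, which vanishes only at `s =
    -- 0`; there the value is `η > 0`. A single branch of the logarithm thus serves the whole inner
    -- arc.
    have hslit : ∀ η : ℝ, 0 < η → ∀ s ∈ Icc (-δ) δ,
        σ * Complex.I * (β s - σ * η * Complex.I) ∈ Complex.slitPlane := by
      intro η hη s hs
      rw [hu]
      have him : (σ * Complex.I * β s + η).im = σ * (β s).re := by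
        simp [Complex.add_im, Complex.mul_im]
      rcases lt_trichotomy s 0 with hs0 | rfl | hs0
      · exact Or.inr (by rw [him]; exact mul_ne_zero hσabs (hβre' s ⟨hs.1, hs0⟩).ne)
      · rw [h0, mul_zero, zero_add]
        exact Complex.ofReal_mem_slitPlane.2 hη
      · exact Or.inr (by rw [him]; exact mul_ne_zero hσabs (hβre s ⟨hs0, hs.2⟩).ne')
    have hpos : ∀ᶠ η in 𝓝[>] (0 : ℝ), 0 < η := eventually_mem_nhdsWithin
    have hin : ∀ η : ℝ, 0 < η → ∀ s ∈ Icc (-δ) δ, β s ≠ σ * η * Complex.I := by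
      intro η hη s hs h'
      have := hslit η hη s hs
      rw [h', sub_self, mul_zero] at this
      exact Complex.slitPlane_ne_zero this rfl
    have hev₁ := hw.eventually (h.eventually_forall_ne hout₁)
    have hev₂ := hw.eventually (h.eventually_forall_ne hout₂)
    refine ⟨?_, ?_⟩
    · have hβδ := hβre δ ⟨hδ, le_rfl⟩
      have hαδ := hαre δ ⟨hδ, le_rfl⟩
      have hlog : ∀ x : ℂ, x.re ≠ 0 →
          Tendsto (fun η : ℝ => Complex.log (σ * Complex.I * (x - σ * η * Complex.I)))
            (𝓝[>] 0) (𝓝 (Complex.log (σ * Complex.I * x))) := by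
        intro x hx
        have h1 := (hw.const_sub x).const_mul (σ * Complex.I)
        rw [sub_zero] at h1
        refine (continuousAt_clog (Or.inr ?_)).tendsto.comp h1
        have : (σ * Complex.I * x).im = σ * x.re := by simp [Complex.mul_im]
        rw [this]
        exact mul_ne_zero hσabs hx
      have hlim := (((h.tendsto_integral_inv_sub (neg_le_neg hδa.le) hout₂).comp hw).add
        ((hlog (β δ) hβδ.ne').sub (hlog (β (-δ)) (hβre' (-δ) ⟨le_rfl, by linarith⟩).ne))).add
        ((h.tendsto_integral_inv_sub hδa.le hout₁).comp hw)
      -- Since `β (-δ) = -α δ`, the two ends turn by opposite quarter turns, whose difference is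
      -- `σπ`.
      have hval : Complex.log (σ * Complex.I * β δ) - Complex.log (σ * Complex.I * β (-δ)) =
          Complex.log (β δ) - Complex.log (α δ) + σ * Real.pi * Complex.I := by
        have h1 : σ * Complex.I * β (-δ) = ((-σ : ℝ) : ℂ) * Complex.I * α δ := by
          rw [hαβ]; push_cast; ring
        have hσ' : -σ = 1 ∨ -σ = -1 := by rcases hσ with rfl | rfl <;> simp
        rw [h1, Complex.log_sign_mul_I_mul hσ hβδ, Complex.log_sign_mul_I_mul hσ' hαδ]
        push_cast
        ring
      rw [hval] at hlim
      have heq : O₂ + (Complex.log (β δ) - Complex.log (α δ) + σ * Real.pi * Complex.I) + O₁ =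
          O₂ + (Complex.log (β δ) - Complex.log (α δ)) + O₁ + σ * Real.pi * Complex.I := by ring
      rw [heq] at hlim
      refine hlim.congr' ?_
      filter_upwards [hpos, hev₁, hev₂] with η hη h1 h2
      have hδδ : -δ ≤ δ := by linarith
      have i1 := h.intervalIntegrable_inv_sub hδa.le h1
      have i2 := h.intervalIntegrable_inv_sub (neg_le_neg hδa.le) h2
      have i3 := h.intervalIntegrable_inv_sub hδδ (hin η hη)
      rw [← intervalIntegral.integral_add_adjacent_intervals (i2.trans i3) i1,
        ← intervalIntegral.integral_add_adjacent_intervals i2 i3,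
        h.integral_inv_sub_mul_deriv hδδ (hslit η hη)]
      rfl
    · filter_upwards [hpos, hev₁, hev₂] with η hη h1 h2 s hs
      rcases le_or_gt s (-δ) with h3 | h3
      · exact h2 s ⟨hs.1, h3⟩
      · rcases le_or_gt δ s with h4 | h4
        · exact h1 s ⟨h4, hs.2⟩
        · exact hin η hη s ⟨h3.le, h4.le⟩

end HasBoundedDeriv

/-! ### Principal values on the contour; the parameter window is centred at the singular point -/

theorem Function.Periodic.integral_zero_one_eq {F : ℝ → ℂ} (hF : Function.Periodic F 1)
    (s₀ : ℝ) : ∫ s in (0 : ℝ)..1, F s = ∫ s in (-(1 / 2) : ℝ)..(1 / 2), F (s₀ + s) := by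
  rw [intervalIntegral.integral_comp_add_left]
  have := hF.intervalIntegral_add_eq 0 (s₀ + -(1 / 2))
  rw [zero_add] at this
  rw [this]
  congr 1
  ring

namespace IsSimpleClosedContour

variable {γ : ℝ → ℂ}

theorem eq_zero_of_apply_add_eq (hγ : IsSimpleClosedContour γ) {s₀ s : ℝ}
    (hs : s ∈ Icc (-(1 / 2) : ℝ) (1 / 2)) (h : γ (s₀ + s) = γ s₀) : s = 0 := by
  have hfract : ∀ x, γ (Int.fract x) = γ x := fun x => by
    have := hγ.periodic.int_mul ⌊x⌋ (Int.fract x)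
    rw [mul_one, Int.fract_add_floor] at this
    exact this.symm
  have h1 : Int.fract (s₀ + s) = Int.fract s₀ :=
    hγ.injOn ⟨Int.fract_nonneg _, Int.fract_lt_one _⟩ ⟨Int.fract_nonneg _, Int.fract_lt_one _⟩
      (by rw [hfract, hfract, h])
  obtain ⟨n, hn⟩ := Int.fract_eq_fract.1 h1
  rw [add_sub_cancel_left] at hn
  have hn1 : (n : ℝ) < 1 := by rw [← hn]; linarith [hs.2]
  have hn2 : (-1 : ℝ) < n := by rw [← hn]; linarith [hs.1]
  have hn1' : n < 1 := by exact_mod_cast hn1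
  have hn2' : -1 < n := by exact_mod_cast hn2
  have : n = 0 := by omega
  rw [hn, this, Int.cast_zero]

theorem contourIntegral_eq (hγ : IsSimpleClosedContour γ) (g : ℂ → ℂ) (s₀ : ℝ) :
    contourIntegral γ g =
      ∫ s in (-(1 / 2) : ℝ)..(1 / 2), g (γ (s₀ + s)) * deriv γ (s₀ + s) :=
  Function.Periodic.integral_zero_one_eq (F := fun s => g (γ s) * deriv γ s)
    (fun s => by simp only [hγ.periodic s, hγ.periodic.deriv_real s]) s₀

theorem exists_apply_add_eq (hγ : IsSimpleClosedContour γ) (s₀ : ℝ) {w : ℂ}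
    (hw : w ∈ range γ) : ∃ s ∈ Icc (-(1 / 2) : ℝ) (1 / 2), γ (s₀ + s) = w := by
  obtain ⟨x, rfl⟩ := hw
  refine ⟨x - s₀ - round (x - s₀), ?_, ?_⟩
  · exact abs_le.1 (abs_sub_round (x - s₀))
  · have := hγ.periodic.sub_int_mul_eq (x := x) (round (x - s₀))
    rw [mul_one] at this
    rw [← this]
    congr 1
    ring

/-- At a smooth point of a positively oriented contour, in the coordinate in which the tangent
direction is that of the positive reals, the principal value of `∮ dt / t` is `πi`. -/
theorem exists_tendsto_truncatedKernel (hγ : IsSimpleClosedContour γ)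
    (hpos : IsPositivelyOriented γ) {s₀ : ℝ} (hs₀ : IsSmoothPoint γ s₀) :
    ∃ e : ℂ, ‖e‖ = 1 ∧ Tendsto (fun ε => ∫ s in (-(1 / 2) : ℝ)..(1 / 2),
      truncatedKernel (fun s => e⁻¹ * (γ (s₀ + s) - γ s₀)) ε s) (𝓝[>] 0)
        (𝓝 (Real.pi * Complex.I)) := by
  obtain ⟨v, hv, c, hc, hleft, hright⟩ := hs₀
  have hv' : (‖v‖ : ℂ) ≠ 0 := by exact_mod_cast norm_ne_zero_iff.2 hv
  set e : ℂ := v / ‖v‖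
  have he : ‖e‖ = 1 := by simp [e, hv]
  have he0 : e ≠ 0 := norm_ne_zero_iff.1 (by rw [he]; exact one_ne_zero)
  have hev : e⁻¹ * v = ‖v‖ := by
    simp only [e]
    field_simp
  refine ⟨e, he, ?_⟩
  set β : ℝ → ℂ := fun s => e⁻¹ * (γ (s₀ + s) - γ s₀) with hβ
  have hβ1 : β = fun s => e⁻¹ * (γ (s₀ + 1 * s) - γ s₀) := by simp [hβ]
  have hβd : ∀ s, deriv β s = e⁻¹ * deriv γ (s₀ + s) := fun s => by
    rw [hβ1, HasBoundedDeriv.deriv_affine]; simp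
  have hβb : HasBoundedDeriv β := by
    rw [hβ1]; exact hγ.hasBoundedDeriv.affine _ _ _ one_ne_zero
  have hderiv : ∀ (S T : Set ℝ) (u : ℂ), HasDerivWithinAt γ u T s₀ →
      MapsTo (fun s => s₀ + s) S T → HasDerivWithinAt β (e⁻¹ * u) S 0 := by
    intro S T u hu hm
    have hu' : HasDerivWithinAt γ u T (s₀ + 0) := by rwa [add_zero]
    have := hu'.scomp (0 : ℝ) ((hasDerivWithinAt_id (0 : ℝ) S).const_add s₀) hm
    rw [one_smul] at this
    exact (this.sub_const (γ s₀)).const_mul e⁻¹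
  have hd₂ : HasDerivWithinAt β (‖v‖ : ℝ) (Iic 0) 0 := by
    rw [← hev]
    exact hderiv _ _ _ hleft fun s hs => by
      simp only [mem_Iic] at hs ⊢
      linarith
  have hd₁ : HasDerivWithinAt β (c * ‖v‖ : ℝ) (Ici 0) 0 := by
    have : ((c * ‖v‖ : ℝ) : ℂ) = e⁻¹ * (c * v) := by
      push_cast
      rw [← hev]
      ring
    rw [this]
    exact hderiv _ _ _ hright fun s hs => by
      simp only [mem_Ici] at hs ⊢
      linarith
  obtain ⟨L, hL, hjump⟩ := hβb.exists_tendsto_principalValue (by simp [hβ])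
    (by positivity) (norm_pos_iff.2 hv) hd₁ hd₂ (a := 1 / 2) (by norm_num) (by
      intro s hs hs0 hz
      rcases mul_eq_zero.1 hz with h | h
      · exact inv_ne_zero he0 h
      · exact hs0 (hγ.eq_zero_of_apply_add_eq hs (sub_eq_zero.1 h)))
  -- For small `η` the shifted point is off the curve, whichever side it lies on, so the integral
  -- takes one of two values; a finite set is closed, so the limit does too.
  have hvalue : ∀ σ : ℝ, σ = 1 ∨ σ = -1 →
      L + σ * Real.pi * Complex.I ∈ ({0, 2 * Real.pi * Complex.I} : Set ℂ) := by
    intro σ hσ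
    obtain ⟨hlim, hoff⟩ := hjump σ hσ
    refine (toFinite _).isClosed.mem_of_tendsto hlim ?_
    filter_upwards [hoff] with η hη
    set w : ℂ := γ s₀ + e * (σ * η * Complex.I)
    have hw : w ∉ range γ := by
      intro hw
      obtain ⟨s, hs, hsw⟩ := hγ.exists_apply_add_eq s₀ hw
      refine hη s hs ?_
      simp only [hβ, hsw, w, add_sub_cancel_left]
      rw [inv_mul_cancel_left₀ he0]
    have hint : ∫ s in (-(1 / 2) : ℝ)..(1 / 2), (β s - σ * η * Complex.I)⁻¹ * deriv β s =
        contourIntegral γ fun t => 1 / (t - w) := by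
      rw [hγ.contourIntegral_eq _ s₀]
      refine intervalIntegral.integral_congr fun s _ => ?_
      have h1 : β s - σ * η * Complex.I = e⁻¹ * (γ (s₀ + s) - w) := by
        simp only [hβ, w]
        field_simp
        ring
      simp only [h1, hβd, mul_inv, inv_inv, one_div]
      field_simp
    rw [hint]
    by_cases hb : Bornology.IsBounded (connectedComponentIn (range γ)ᶜ w)
    · exact Or.inr (contourIntegral_inv_inside hpos ⟨hw, hb⟩)
    · exact Or.inl (hγ.contourIntegral_inv_eq_zero ⟨hw, hb⟩)
  have hpi : (Real.pi : ℂ) * Complex.I ≠ 0 :=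
    mul_ne_zero (by exact_mod_cast Real.pi_ne_zero) Complex.I_ne_zero
  have hLeq : L = Real.pi * Complex.I := by
    have hp := hvalue 1 (Or.inl rfl)
    have hm := hvalue (-1) (Or.inr rfl)
    simp only [mem_insert_iff, mem_singleton_iff, Complex.ofReal_one, Complex.ofReal_neg] at hp hm
    rcases hp with hp | hp
    · exfalso
      rcases hm with hm | hm
      · exact hpi (by linear_combination (1 / 2) * hp - (1 / 2) * hm)
      · exact hpi (by linear_combination (1 / 4) * hp - (1 / 4) * hm)
    · linear_combination hp
  rwa [hLeq] at hL

/-- Subtracting `g(z)/(t - z)` leaves `dslope g z`, whose truncated integrals converge by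
domination. The rotation `e` has modulus one, so it affects neither the cutoff nor `dt/(t - z)`. -/
theorem hasCauchyPrincipalValue (hγ : IsSimpleClosedContour γ) (hpos : IsPositivelyOriented γ)
    {U : Set ℂ} (hU : IsOpen U) (hKU : insideDomain γ ∪ range γ ⊆ U) {g : ℂ → ℂ}
    (hg : DifferentiableOn ℂ g U) {s₀ : ℝ} (hs₀ : IsSmoothPoint γ s₀) :
    HasCauchyPrincipalValue γ g (γ s₀) (Real.pi * Complex.I * g (γ s₀)) := by
  obtain ⟨e, he, hker⟩ := hγ.exists_tendsto_truncatedKernel hpos hs₀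
  have he0 : e ≠ 0 := norm_ne_zero_iff.1 (by rw [he]; exact one_ne_zero)
  set z := γ s₀ with hz
  set β : ℝ → ℂ := fun s => e⁻¹ * (γ (s₀ + s) - z) with hβ
  have hβ1 : β = fun s => e⁻¹ * (γ (s₀ + 1 * s) - z) := by simp [hβ]
  have hβd : ∀ s, deriv β s = e⁻¹ * deriv γ (s₀ + s) := fun s => by
    rw [hβ1, HasBoundedDeriv.deriv_affine]; simp
  have hβb : HasBoundedDeriv β := by
    rw [hβ1]; exact hγ.hasBoundedDeriv.affine _ _ _ one_ne_zero
  have hβn : ∀ s, ‖β s‖ = ‖γ (s₀ + s) - z‖ := fun s => by simp [hβ, he]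
  have hγU : range γ ⊆ U := subset_union_right.trans hKU
  have hzU : z ∈ U := hγU (mem_range_self s₀)
  have hdc : Continuous fun s => dslope g z (γ (s₀ + s)) :=
    (hγ.continuous_dslope_comp hU hγU hg hzU).comp (continuous_const.add continuous_id)
  set D : ℝ → ℂ := fun s => dslope g z (γ (s₀ + s)) * deriv γ (s₀ + s) with hD
  have hDm : Measurable D := hdc.measurable.mul
    ((measurable_deriv γ).comp (measurable_const.add measurable_id))
  have hDi : IntervalIntegrable D volume (-(1 / 2)) (1 / 2) := by
    have h1 := (hβb.intervalIntegrable_mul (a := -(1 / 2)) (b := 1 / 2)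
      hdc.continuousOn).const_mul e
    refine h1.congr fun s _ => ?_
    simp only [hD, hβd]
    field_simp
  have hDlim : Tendsto (fun ε : ℝ => ∫ s in (-(1 / 2) : ℝ)..(1 / 2),
      {s | ε < ‖β s‖}.indicator D s) (𝓝[>] 0) (𝓝 0) := by
    -- Dixon's argument covers all of `U`, in particular the boundary point `z`.
    have hzero : ∫ s in (-(1 / 2) : ℝ)..(1 / 2), D s = 0 := by
      rw [← (hγ.contourIntegral_dslope_eq_zero hU hKU hg).1 z hzU, hγ.contourIntegral_eq _ s₀]
    rw [← hzero]
    refine intervalIntegral.tendsto_integral_filter_of_dominated_convergence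
      (fun s => ‖D s‖) ?_ ?_ hDi.norm ?_
    · exact Eventually.of_forall fun ε => (hDm.indicator
        (measurableSet_lt measurable_const hβb.continuous.measurable.norm)).aestronglyMeasurable
    · exact Eventually.of_forall fun ε => ae_of_all _ fun s _ => norm_indicator_le_norm_self _ _
    · have h0 : ∀ᵐ s : ℝ, s ≠ 0 := by
        rw [ae_iff]
        simp
      filter_upwards [h0] with s hs0 hs
      rw [uIoc_of_le (by norm_num)] at hs
      have hp : 0 < ‖β s‖ := by
        rw [hβn, norm_pos_iff, sub_ne_zero]
        exact fun h => hs0 (hγ.eq_zero_of_apply_add_eq (Ioc_subset_Icc_self hs) h)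
      refine tendsto_const_nhds.congr' ?_
      filter_upwards [nhdsWithin_le_nhds (eventually_lt_nhds hp)] with ε hε
      exact (indicator_of_mem (s := {s | ε < ‖β s‖}) hε D).symm
  have hsum := hDlim.add (hker.mul_const (g z))
  rw [zero_add] at hsum
  refine hsum.congr' ?_
  have hpos' : ∀ᶠ ε in 𝓝[>] (0 : ℝ), 0 < ε := eventually_mem_nhdsWithin
  filter_upwards [hpos'] with ε hε
  have hmeas : MeasurableSet {s | ε < ‖γ s - z‖} :=
    measurableSet_lt measurable_const
      (hγ.continuous.sub continuous_const).measurable.norm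
  have hset : {s : ℝ | s ∈ Icc (0 : ℝ) 1 ∧ ε < ‖γ s - z‖} =
      Icc 0 1 ∩ {s | ε < ‖γ s - z‖} := rfl
  rw [hset, ← setIntegral_indicator hmeas, integral_Icc_eq_integral_Ioc,
    ← intervalIntegral.integral_of_le zero_le_one,
    Function.Periodic.integral_zero_one_eq (s₀ := s₀), ← intervalIntegral.integral_mul_const,
    ← intervalIntegral.integral_add]
  · refine intervalIntegral.integral_congr fun s _ => ?_
    rcases lt_or_ge ε ‖β s‖ with hlt | hle
    · have hlt' : ε < ‖γ (s₀ + s) - z‖ := hβn s ▸ hlt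
      have hne : γ (s₀ + s) - z ≠ 0 := norm_pos_iff.1 (hε.trans hlt')
      rw [truncatedKernel_of_lt hlt, indicator_of_mem (s := {s | ε < ‖β s‖}) hlt,
        indicator_of_mem (s := {s | ε < ‖γ s - z‖}) hlt', hβd]
      simp only [hD, hβ, dslope_of_ne _ (sub_ne_zero.1 hne), slope_def_field]
      field_simp
      ring
    · have hle' : ¬ ε < ‖γ (s₀ + s) - z‖ := not_lt.2 (hβn s ▸ hle)
      rw [truncatedKernel_of_le hle, indicator_of_notMem (s := {s | ε < ‖β s‖}) (not_lt.2 hle),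
        indicator_of_notMem (s := {s | ε < ‖γ s - z‖}) hle', zero_mul, add_zero]
  · refine hDi.mono_fun (hDm.indicator
      (measurableSet_lt measurable_const hβb.continuous.measurable.norm)).aestronglyMeasurable
      (ae_of_all _ fun s => norm_indicator_le_norm_self _ _)
  · exact (hβb.intervalIntegrable_truncatedKernel hε _ _).mul_const _
  · intro s
    simp only [indicator_apply, mem_ofPred_eq, hγ.periodic s, hγ.periodic.deriv_real s]

theorem cauchyIntegral_eq_of_mem_insideDomain (hγ : IsSimpleClosedContour γ)
    (hpos : IsPositivelyOriented γ) {U : Set ℂ} (hU : IsOpen U)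
    (hKU : insideDomain γ ∪ range γ ⊆ U) {g : ℂ → ℂ} (hg : DifferentiableOn ℂ g U) {w : ℂ}
    (hw : w ∈ insideDomain γ) : cauchyIntegral γ g w = g w := by
  have hgγ : Continuous fun s => g (γ s) := hg.continuousOn.comp_continuous hγ.continuous
    fun s => hKU (Or.inr (mem_range_self s))
  have h1 := (hγ.contourIntegral_dslope_eq_zero hU hKU hg).1 w (hKU (Or.inl hw))
  rw [hγ.contourIntegral_dslope_of_notMem hgγ hw.1, contourIntegral_inv_inside hpos hw,
    sub_eq_zero] at h1
  have := Complex.two_pi_I_ne_zero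
  rw [cauchyIntegral, h1]
  field_simp

theorem cauchyIntegral_eq_zero_of_mem_outsideDomain (hγ : IsSimpleClosedContour γ)
    {U : Set ℂ} (hU : IsOpen U) (hKU : insideDomain γ ∪ range γ ⊆ U) {g : ℂ → ℂ}
    (hg : DifferentiableOn ℂ g U) {w : ℂ} (hw : w ∈ outsideDomain γ) :
    cauchyIntegral γ g w = 0 := by
  rw [cauchyIntegral, (hγ.contourIntegral_dslope_eq_zero hU hKU hg).2 w hw, mul_zero]

end IsSimpleClosedContour

/-! ### The theorem -/

theorem theorem8 (γ : ℝ → ℂ) (hγ : IsSimpleClosedContour γ) (hpos : IsPositivelyOriented γ)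
    (f : ℂ → ℂ) (hfD : DifferentiableOn ℂ f (insideDomain γ))
    (N : Set ℂ) (hN : IsOpen N) (hCN : range γ ⊆ N) (hfN : DifferentiableOn ℂ f N)
    (n : ℕ) :
    UniformContinuousOn (iteratedDeriv n f) (insideDomain γ ∪ range γ) ∧
    (∀ z ∈ range γ,
      Tendsto (iteratedDeriv n f) (𝓝[insideDomain γ] z) (𝓝 (iteratedDeriv n f z))) ∧
    (∀ s : ℝ, IsSmoothPoint γ s →
      ∃ P : ℂ, HasCauchyPrincipalValue γ (iteratedDeriv n f) (γ s) P ∧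
        iteratedDeriv n f (γ s) = 1 / (Real.pi * Complex.I) * P ∧
        Tendsto (cauchyIntegral γ (iteratedDeriv n f)) (𝓝[insideDomain γ] (γ s))
          (𝓝 (1 / 2 * iteratedDeriv n f (γ s) + 1 / (2 * Real.pi * Complex.I) * P)) ∧
        Tendsto (cauchyIntegral γ (iteratedDeriv n f)) (𝓝[outsideDomain γ] (γ s))
          (𝓝 (-(1 / 2) * iteratedDeriv n f (γ s) + 1 / (2 * Real.pi * Complex.I) * P))) := by
  have hU : IsOpen (insideDomain γ ∪ N) := hγ.isOpen_insideDomain.union hN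
  have hKU : insideDomain γ ∪ range γ ⊆ insideDomain γ ∪ N := union_subset_union_right _ hCN
  have hf : DifferentiableOn ℂ f (insideDomain γ ∪ N) :=
    hfD.union_of_isOpen hfN hγ.isOpen_insideDomain hN
  have hg : DifferentiableOn ℂ (iteratedDeriv n f) (insideDomain γ ∪ N) := by
    rw [iteratedDeriv_eq_iterate]
    exact ((hf.analyticOnNhd hU).iterated_deriv n).differentiableOn
  have hlim : ∀ z ∈ range γ,
      Tendsto (iteratedDeriv n f) (𝓝[insideDomain γ] z) (𝓝 (iteratedDeriv n f z)) := fun z hz =>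
    ((hg.continuousOn.continuousAt (hU.mem_nhds (hKU (Or.inr hz)))).tendsto).mono_left
      nhdsWithin_le_nhds
  refine ⟨hγ.isCompact_insideDomain_union_range.uniformContinuousOn_of_continuous
    (hg.continuousOn.mono hKU), hlim, fun s hs => ?_⟩
  have hpi : (Real.pi : ℂ) ≠ 0 := by exact_mod_cast Real.pi_ne_zero
  have hI := Complex.I_ne_zero
  -- With `P = πi g(z)` the two claimed limits are `g(z)` and `0`, the limits of the exact values of
  -- the Cauchy integral on either side.
  refine ⟨_, hγ.hasCauchyPrincipalValue hpos hU hKU hg hs, by field_simp, ?_, ?_⟩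
  · have hval : 1 / 2 * iteratedDeriv n f (γ s) + 1 / (2 * Real.pi * Complex.I) *
        (Real.pi * Complex.I * iteratedDeriv n f (γ s)) = iteratedDeriv n f (γ s) := by
      field_simp
      ring
    rw [hval]
    refine (hlim _ (mem_range_self s)).congr' ?_
    filter_upwards [self_mem_nhdsWithin] with w hw
    exact (hγ.cauchyIntegral_eq_of_mem_insideDomain hpos hU hKU hg hw).symm
  · have hval : -(1 / 2) * iteratedDeriv n f (γ s) + 1 / (2 * Real.pi * Complex.I) *
        (Real.pi * Complex.I * iteratedDeriv n f (γ s)) = 0 := by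
      field_simp
      ring
    rw [hval]
    refine tendsto_const_nhds.congr' ?_
    filter_upwards [self_mem_nhdsWithin] with w hw
    exact (hγ.cauchyIntegral_eq_zero_of_mem_outsideDomain hU hKU hg hw).symm
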